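/- An instance of (3,4)-SAT is a CNF formula in which every clause consists of exactly three literals on three different variables and every variable occurs in at most four clauses. For integers $a,b\ge 0$ write $[a]=\{0,\dots,a-1\}$. An instance $(G,\beta,L)$ of Nonuniform List $(a{:}b)$-Coloring consists of a finite simple graph $G$, a demand function $\beta\colon V(G)\to\{1,\dots,b\}$ and lists $L\colon V(G)\to 2^{[a]}$; it is a YES-instance if one can choose for each vertex $v$ a set $\alpha(v)\subseteq L(v)$ of exactly $\beta(v)$ colors such that $\alpha(u)\cap\alpha(v)=\emptyset$ for all adjacent $u,v$. Theorem. For every instance $\phi$ of (3,4)-SAT with $n$ variables and every integer $b$ with $2\le b\le n/\log_2 n$ there are an integer $a=O(b^2\log b)$ and an instance $(G,\beta,L)$ of Nonuniform List $(a{:}2b)$-Coloring with $|V(G)|=O(n/\log b)$ such that $G$ is $3$-colorable, and $(G,\beta,L)$ is a YES-instance if and only if $\phi$ is satisfiable. Moreover, a single deterministic algorithm, given $\phi$ and $b$, outputs such an instance $(G,\beta,L)$ together with a proper $3$-coloring of $G$ in time polynomial in $n$. The constants hidden in the $O$-notation and the polynomial are absolute. -/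

import Mathlib

namespace ListColoring

/-! ### CNF formulas and (3,4)-SAT -/

/-- A literal over the variables `0, …, n-1`: a variable together with its sign
(`true` for the positive literal, `false` for the negated one). -/
abbrev Literal (n : ℕ) := Fin n × Bool

/-- A clause is a (finite) disjunction of literals. -/
abbrev Clause (n : ℕ) := List (Literal n)

/-- A CNF formula with `n` variables is a (finite) conjunction of clauses. -/
abbrev CNF (n : ℕ) := List (Clause n)

/-- The assignment `η` satisfies every clause of `φ`. -/
def CNF.SatisfiedBy {n : ℕ} (φ : CNF n) (η : Fin n → Bool) : Prop :=
  ∀ c ∈ φ, ∃ l ∈ c, η l.1 = l.2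

def CNF.Satisfiable {n : ℕ} (φ : CNF n) : Prop :=
  ∃ η : Fin n → Bool, φ.SatisfiedBy η

/-- Instances of (3,4)-SAT: every clause consists of exactly three literals, on three
different variables, and every variable occurs in at most four clauses. -/
def CNF.Is34 {n : ℕ} (φ : CNF n) : Prop :=
  (∀ c ∈ φ, c.length = 3 ∧ (c.map Prod.fst).Nodup) ∧
  ∀ x : Fin n, φ.countP (fun c => decide (x ∈ c.map Prod.fst)) ≤ 4

/-! ### Nonuniform list (a:b)-coloring -/

/-- An instance `(G, β, L)` of Nonuniform List (a:b)-Coloring, on the vertices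
`0, …, numVertices - 1`: a simple graph, a list of colors from `[a] = {0, …, a-1}` for each
vertex, and a demand in `{1, …, b}` for each vertex. -/
structure NonuniformInstance (a b : ℕ) where
  numVertices : ℕ
  graph : SimpleGraph (Fin numVertices)
  list : Fin numVertices → Finset (Fin a)
  demand : Fin numVertices → ℕ
  one_le_demand : ∀ v, 1 ≤ demand v
  demand_le : ∀ v, demand v ≤ b

/-- `α` is an `L`-(a:β)-coloring of `G`: every vertex `v` receives exactly `β v` colors from its
list, and adjacent vertices receive disjoint sets of colors. -/
def NonuniformInstance.IsColoring {a b : ℕ} (I : NonuniformInstance a b)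
    (α : Fin I.numVertices → Finset (Fin a)) : Prop :=
  (∀ v, α v ⊆ I.list v ∧ (α v).card = I.demand v) ∧
  ∀ u v, I.graph.Adj u v → Disjoint (α u) (α v)

def NonuniformInstance.Colorable {a b : ℕ} (I : NonuniformInstance a b) : Prop :=
  ∃ α : Fin I.numVertices → Finset (Fin a), I.IsColoring α

/-! ### A machine model with a cost measure

Programs of a WHILE language over binary trees (the data of pure Lisp: `nil` and `cons`).
A program maps one tree to one tree. -/

/-- The data on which programs operate: unlabelled binary trees. -/
abbrev Data := BinaryTree Unit

inductive Prog
  | id : Prog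
  | nil : Prog
  | left : Prog
  | right : Prog
  | eq : Prog
  | pair (f g : Prog) : Prog
  | comp (g f : Prog) : Prog
  | cond (c f g : Prog) : Prog
  | loop (c f : Prog) : Prog

/-- `Prog.Runs p x y t`: on input `x` the program `p` terminates with output `y`, at cost `t`.

Every elementary step is charged the size of the tree it is applied to (its number of leaves,
which is at least `1`; one more for `eq`), so a cost bounds both the number of steps and the size of all trees that
occur in the run. A multitape Turing machine simulates a run of cost `t` in time polynomial in
`t`, and conversely `T` steps of a Turing machine are simulated at cost polynomial in `T` and the
size of the input. Hence "cost polynomial in `n`" is the usual "time polynomial in `n`".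

The tree `nil` is the truth value false, every other tree is true. -/
inductive Prog.Runs : Prog → Data → Data → ℕ → Prop
  | id (x : Data) : Runs .id x x x.numLeaves
  | nil (x : Data) : Runs .nil x .nil x.numLeaves
  | left (x : Data) : Runs .left x x.left x.numLeaves
  | right (x : Data) : Runs .right x x.right x.numLeaves
  | eq (x : Data) :
      Runs .eq x (if x.left = x.right then .node () .nil .nil else .nil) (x.numLeaves + 1)
  | pair {f g : Prog} {x y z : Data} {s t : ℕ} :
      Runs f x y s → Runs g x z t → Runs (.pair f g) x (.node () y z) (s + t + x.numLeaves)
  | comp {f g : Prog} {x y z : Data} {s t : ℕ} :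
      Runs f x y s → Runs g y z t → Runs (.comp g f) x z (s + t + x.numLeaves)
  | cond_true {c f g : Prog} {x w y : Data} {s t : ℕ} :
      Runs c x w s → w ≠ .nil → Runs f x y t → Runs (.cond c f g) x y (s + t + x.numLeaves)
  | cond_false {c f g : Prog} {x y : Data} {s t : ℕ} :
      Runs c x .nil s → Runs g x y t → Runs (.cond c f g) x y (s + t + x.numLeaves)
  | loop_done {c f : Prog} {x : Data} {s : ℕ} :
      Runs c x .nil s → Runs (.loop c f) x x (s + x.numLeaves)
  | loop_step {c f : Prog} {x w y z : Data} {s t r : ℕ} :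
      Runs c x w s → w ≠ .nil → Runs f x y t → Runs (.loop c f) y z r →
      Runs (.loop c f) x z (s + t + r + x.numLeaves)

/-- Programs are deterministic: output and cost are determined by the input. -/
theorem Prog.Runs.deterministic {p : Prog} {x y y' : Data} {t t' : ℕ}
    (h : p.Runs x y t) (h' : p.Runs x y' t') : y = y' ∧ t = t' := by
  induction h generalizing y' t' with
  | id | nil | left | right | eq => cases h'; exact ⟨rfl, rfl⟩
  | pair _ _ ih₁ ih₂ =>
    cases h' with
    | pair a b => obtain ⟨rfl, rfl⟩ := ih₁ a; obtain ⟨rfl, rfl⟩ := ih₂ b; exact ⟨rfl, rfl⟩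
  | comp _ _ ih₁ ih₂ =>
    cases h' with
    | comp a b => obtain ⟨rfl, rfl⟩ := ih₁ a; obtain ⟨rfl, rfl⟩ := ih₂ b; exact ⟨rfl, rfl⟩
  | cond_true _ hw _ ih₁ ih₂ =>
    cases h' with
    | cond_true a _ b => obtain ⟨rfl, rfl⟩ := ih₁ a; obtain ⟨rfl, rfl⟩ := ih₂ b; exact ⟨rfl, rfl⟩
    | cond_false a _ => exact absurd (ih₁ a).1 hw
  | cond_false _ _ ih₁ ih₂ =>
    cases h' with
    | cond_true a hw _ => exact absurd (ih₁ a).1.symm hw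
    | cond_false a b => obtain ⟨-, rfl⟩ := ih₁ a; obtain ⟨rfl, rfl⟩ := ih₂ b; exact ⟨rfl, rfl⟩
  | loop_done _ ih₁ =>
    cases h' with
    | loop_done a => obtain ⟨-, rfl⟩ := ih₁ a; exact ⟨rfl, rfl⟩
    | loop_step a hw _ _ => exact absurd (ih₁ a).1.symm hw
  | loop_step _ hw _ _ ih₁ ih₂ ih₃ =>
    cases h' with
    | loop_done a => exact absurd (ih₁ a).1 hw
    | loop_step a _ b c =>
      obtain ⟨rfl, rfl⟩ := ih₁ a
      obtain ⟨rfl, rfl⟩ := ih₂ b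
      obtain ⟨rfl, rfl⟩ := ih₃ c
      exact ⟨rfl, rfl⟩

/-! ### Encodings of inputs and outputs -/

/-- The list `[x₁, …, xₖ]` as the tree `cons x₁ (cons x₂ (… (cons xₖ nil)))`. -/
def encodeList (l : List Data) : Data :=
  l.foldr (fun x y => .node () x y) .nil

/-- Natural numbers are written in unary. (All numbers in inputs and outputs are bounded by a
polynomial in the number of variables of the formula.) -/
def encodeNat (k : ℕ) : Data :=
  encodeList (List.replicate k .nil)

def encodeBool (x : Bool) : Data :=
  if x then .node () .nil .nil else .nil

def encodeLiteral {n : ℕ} (l : Literal n) : Data :=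
  .node () (encodeNat l.1) (encodeBool l.2)

def encodeClause {n : ℕ} (c : Clause n) : Data :=
  encodeList (c.map encodeLiteral)

/-- The input of the algorithm: the number of variables, the number `b`, and the clauses. -/
def encodeInput {n : ℕ} (φ : CNF n) (b : ℕ) : Data :=
  encodeList [encodeNat n, encodeNat b, encodeList (φ.map encodeClause)]

open Classical in
/-- The output of the algorithm: `a`, `b`, the number of vertices, the adjacency matrix, the
characteristic vectors of the color lists, the demands, and the 3-coloring of the graph. -/
noncomputable def encodeOutput {a b : ℕ} (I : NonuniformInstance a b)
    (χ : I.graph.Coloring (Fin 3)) : Data :=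
  encodeList
    [encodeNat a,
     encodeNat b,
     encodeNat I.numVertices,
     encodeList (List.ofFn fun u =>
       encodeList (List.ofFn fun v => encodeBool (decide (I.graph.Adj u v)))),
     encodeList (List.ofFn fun v =>
       encodeList (List.ofFn fun x => encodeBool (decide (x ∈ I.list v)))),
     encodeList (List.ofFn fun v => encodeNat (I.demand v)),
     encodeList (List.ofFn fun v => encodeNat (χ v : Fin 3))]

end ListColoring

/-!
The reduction groups `k = Θ(log b)` variables into one vertex. The greedy lemma `greedy_spec`
provides three distributions: of the variables into `O(n / k)` groups of at most `k`, such that no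
clause meets a group twice; of the clauses into groups of at most `m = k * 4 ^ (k - 1)`, such that
all literals in a group of clauses belong to different groups of variables; and of the groups of
variables into `O(k * m)` slots, such that groups of variables that meet the same group of clauses
have different slots. A color is a slot together with a Boolean vector of length `k`. The vertex of
a group of variables uses all but one of the `2 ^ k` colors of its slot, and the color that is left
over is the assignment.

A group of `m'` clauses thus has `3 * m'` colors, one per literal, that its vertices are free to
use. One vertex selects `m'` of those that make their literal true, an adjacent one uses up the
other `2 * m'`. The formula is satisfied if one color of every clause is selected, and a vertex
adjacent to the second one can enforce that at least `|R|` colors are selected in a given set `R` of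
clauses. Doing this for a set and for its complement enforces equality. It remains to find few sets
`R` such that these equalities imply that exactly one color of every clause is selected. Such
sets are the rows of a detecting matrix, which needs only `4 ^ k = 4 * m / k` rows for `m`
columns (`detectRows_detects`): four copies of a matrix are combined according to the `4 × 4` matrix
with zeros on the diagonal and ones elsewhere, whose column sums are `3`, so that one more entry
`z` in `[-1, 2]` per row of the old matrix is found to be zero, being divisible by `3`.
So there are `O(n / k)` vertices in total. The equivalence is
`Input.sat_of_coloring` and `Input.coloring_of_sat`, and the bounds are
`Input.length_palette_le` and `Input.groupSize_mul_length_vertices_le`.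

For the running time, `PolyTime f` says that a program computes `f` on encodings at polynomial cost.
The central closure property is `PolyTime.foldl`: a fold whose states stay small is computed by
a loop. From it the usual operations on lists and on numbers in unary follow, and the whole
construction is composed of them.
-/

namespace ListColoring

open Polynomial

/-! ### Polynomial-time functions on encoded data -/

/-- Types whose elements are represented, injectively, by binary trees. -/
class Enc (α : Type) where
  enc : α → Data
  inj : Function.Injective enc

open Enc (enc)

/-- The size of an object is the number of leaves of its encoding. -/
def esize {α : Type} [Enc α] (a : α) : ℕ := (enc a).numLeaves

theorem encodeList_injective : Function.Injective encodeList := by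
  intro l
  induction l with
  | nil => intro l' h; cases l' with
    | nil => rfl
    | cons a l' => simp [encodeList] at h
  | cons a l ih => intro l' h; cases l' with
    | nil => simp [encodeList] at h
    | cons b l' =>
      simp only [encodeList, List.foldr_cons, BinaryTree.node.injEq, true_and] at h
      rw [h.1, ih h.2]

theorem encodeNat_injective : Function.Injective encodeNat := fun a b h => by
  simpa using congrArg List.length (encodeList_injective h)

theorem encodeBool_injective : Function.Injective encodeBool := by
  intro a b h
  cases a <;> cases b <;> simp_all [encodeBool]

instance : Enc Unit := ⟨fun _ => .nil, fun _ _ _ => rfl⟩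
instance : Enc Bool := ⟨encodeBool, encodeBool_injective⟩
instance : Enc ℕ := ⟨encodeNat, encodeNat_injective⟩

section

variable {α β γ σ δ : Type} [Enc α] [Enc β] [Enc γ] [Enc σ] [Enc δ]

instance : Enc (α × β) :=
  ⟨fun p => .node () (enc p.1) (enc p.2), fun p q h => by
    simp only [BinaryTree.node.injEq, true_and] at h
    exact Prod.ext (Enc.inj h.1) (Enc.inj h.2)⟩

instance : Enc (List α) :=
  ⟨fun l => encodeList (l.map enc), fun _ _ h =>
    List.map_injective_iff.2 Enc.inj (encodeList_injective h)⟩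

instance {p : α → Prop} : Enc (Subtype p) :=
  ⟨fun a => enc a.1, fun _ _ h => Subtype.ext (Enc.inj h)⟩

theorem enc_pair (a : α) (b : β) : enc (a, b) = .node () (enc a) (enc b) := rfl
theorem enc_nil : enc ([] : List α) = .nil := rfl
theorem enc_cons (a : α) (l : List α) : enc (a :: l) = .node () (enc a) (enc l) := rfl
theorem enc_true : enc true = .node () .nil .nil := rfl
theorem enc_false : enc false = .nil := rfl

@[simp] theorem esize_pair (a : α) (b : β) : esize (a, b) = esize a + esize b := rfl
@[simp] theorem esize_nil : esize ([] : List α) = 1 := rfl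
@[simp] theorem esize_cons (a : α) (l : List α) : esize (a :: l) = esize a + esize l := rfl

theorem one_le_numLeaves (x : Data) : 1 ≤ x.numLeaves := by
  rw [x.numLeaves_eq_numNodes_succ]; omega

theorem one_le_esize (a : α) : 1 ≤ esize a := one_le_numLeaves _

@[simp] theorem esize_nat (n : ℕ) : esize n = n + 1 := by
  change (encodeList (List.replicate n .nil)).numLeaves = n + 1
  induction n with
  | zero => rfl
  | succ n ih =>
    simp only [List.replicate_succ, encodeList, List.foldr_cons, BinaryTree.numLeaves] at ih ⊢
    omega

theorem esize_bool (b : Bool) : esize b ≤ 2 := by cases b <;> decide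

theorem esize_append (l l' : List α) : esize (l ++ l') + 1 = esize l + esize l' := by
  induction l with
  | nil => simp [Nat.add_comm]
  | cons a l ih => simp only [List.cons_append, esize_cons]; omega

theorem length_lt_esize (l : List α) : l.length < esize l := by
  induction l with
  | nil => simp
  | cons a l ih => have := one_le_esize a; simp only [List.length_cons, esize_cons]; omega

theorem esize_le_of_mem {l : List α} {a : α} (h : a ∈ l) : esize a ≤ esize l := by
  induction l with
  | nil => simp at h
  | cons b l ih =>
    rcases List.mem_cons.1 h with rfl | h
    · simp
    · have := ih h; simp only [esize_cons]; omega

theorem esize_list_le {l : List α} {s : ℕ} (h : ∀ a ∈ l, esize a ≤ s) :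
    esize l ≤ l.length * s + 1 := by
  induction l with
  | nil => simp
  | cons a l ih =>
    have h1 := ih fun b hb => h b (List.mem_cons_of_mem _ hb)
    have h2 := h a List.mem_cons_self
    simp only [List.length_cons, esize_cons, Nat.succ_mul]; omega

theorem esize_le_of_prefix {l l' : List α} (h : l' <+: l) : esize l' ≤ esize l := by
  obtain ⟨r, rfl⟩ := h
  have := esize_append l' r
  have := one_le_esize r
  omega

theorem Prog.Runs.numLeaves_le {p : Prog} {x y : Data} {t : ℕ} (h : p.Runs x y t) :
    y.numLeaves ≤ t := by
  induction h with
  | id | nil => simp [one_le_numLeaves]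
  | left x => cases x <;> simp [BinaryTree.left]
  | right x => cases x <;> simp [BinaryTree.right]
  | eq x =>
    have := one_le_numLeaves x
    split
    · simp only [BinaryTree.numLeaves]; omega
    · simp only [BinaryTree.numLeaves]; omega
  | pair _ _ h1 h2 => simp only [BinaryTree.numLeaves]; omega
  | _ => omega

theorem eval_mono (P : ℕ[X]) {m n : ℕ} (h : m ≤ n) : P.eval m ≤ P.eval n := by
  induction P using Polynomial.induction_on' with
  | add p q hp hq => simp only [eval_add]; omega
  | monomial k c => simp only [eval_monomial]; gcongr

/-- `f` is computed, on encodings, by a program whose cost is polynomial in the size of the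
input. -/
@[fun_prop]
def PolyTime (f : α → β) : Prop :=
  ∃ (p : Prog) (P : ℕ[X]), ∀ x, ∃ t, t ≤ P.eval (esize x) ∧ p.Runs (enc x) (enc (f x)) t

/-- A quantity bounded by a polynomial in the size of the argument. -/
def PolyBdd (f : α → ℕ) : Prop := ∃ P : ℕ[X], ∀ x, f x ≤ P.eval (esize x)

namespace PolyBdd

theorem mono {f g : α → ℕ} (hg : PolyBdd g) (h : ∀ x, f x ≤ g x) : PolyBdd f :=
  let ⟨P, hP⟩ := hg
  ⟨P, fun x => (h x).trans (hP x)⟩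

theorem const (c : ℕ) : PolyBdd (fun _ : α => c) := ⟨C c, fun _ => by simp⟩

theorem size : PolyBdd (fun x : α => esize x) := ⟨X, fun _ => by simp⟩

theorem add {f g : α → ℕ} (hf : PolyBdd f) (hg : PolyBdd g) : PolyBdd fun x => f x + g x :=
  let ⟨P, hP⟩ := hf
  let ⟨Q, hQ⟩ := hg
  ⟨P + Q, fun x => by rw [eval_add]; exact Nat.add_le_add (hP x) (hQ x)⟩

theorem mul {f g : α → ℕ} (hf : PolyBdd f) (hg : PolyBdd g) : PolyBdd fun x => f x * g x :=
  let ⟨P, hP⟩ := hf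
  let ⟨Q, hQ⟩ := hg
  ⟨P * Q, fun x => by rw [eval_mul]; exact Nat.mul_le_mul (hP x) (hQ x)⟩

theorem eval {f : α → ℕ} (P : ℕ[X]) (hf : PolyBdd f) : PolyBdd fun x => P.eval (f x) :=
  let ⟨Q, hQ⟩ := hf
  ⟨P.comp Q, fun x => by rw [eval_comp]; exact eval_mono P (hQ x)⟩

end PolyBdd

theorem polyTime_iff {f : α → β} : PolyTime f ↔
    ∃ (p : Prog) (B : α → ℕ), PolyBdd B ∧ ∀ x, ∃ t ≤ B x, p.Runs (enc x) (enc (f x)) t :=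
  ⟨fun ⟨p, P, h⟩ => ⟨p, fun x => P.eval (esize x), ⟨P, fun _ => le_rfl⟩, h⟩,
    fun ⟨p, _, ⟨P, hP⟩, h⟩ => ⟨p, P, fun x =>
      let ⟨t, ht, hr⟩ := h x
      ⟨t, ht.trans (hP x), hr⟩⟩⟩

namespace PolyTime

theorem polyBdd {f : α → β} (hf : PolyTime f) : PolyBdd fun x => esize (f x) :=
  let ⟨_, P, h⟩ := hf
  ⟨P, fun x =>
    let ⟨_, ht, hr⟩ := h x
    hr.numLeaves_le.trans ht⟩

/-- A size bound, available to nested calls, for the results of a function of two arguments. -/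
theorem exists_bound {f : γ → α → β} (hf : PolyTime fun p : γ × α => f p.1 p.2) :
    ∃ P : ℕ[X], ∀ x a, esize (f x a) ≤ P.eval (esize x + esize a) :=
  let ⟨P, hP⟩ := hf.polyBdd
  ⟨P, fun x a => hP (x, a)⟩

@[fun_prop] theorem id : PolyTime (fun x : α => x) :=
  ⟨.id, X, fun x => ⟨_, by simp [esize], .id _⟩⟩

/-- Functions between different types with the same underlying trees are computed by the same
program. -/
theorem of_enc_eq {f : α → β} {g : α → γ} (hf : PolyTime f) (h : ∀ x, enc (g x) = enc (f x)) :
    PolyTime g :=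
  let ⟨p, P, hp⟩ := hf
  ⟨p, P, fun x => by rw [h x]; exact hp x⟩

@[fun_prop] theorem comp {f : β → γ} {g : α → β} (hf : PolyTime f) (hg : PolyTime g) :
    PolyTime fun x => f (g x) := by
  obtain ⟨p, P, hp⟩ := hf
  obtain ⟨q, B, hB, hq⟩ := polyTime_iff.1 hg
  refine polyTime_iff.2 ⟨.comp p q, fun x => B x + P.eval (esize (g x)) + esize x,
    (hB.add (.eval P (polyBdd hg))).add .size, fun x => ?_⟩
  obtain ⟨t, ht, hr⟩ := hq x
  obtain ⟨t', ht', hr'⟩ := hp (g x)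
  exact ⟨_, Nat.add_le_add (Nat.add_le_add ht ht') le_rfl, .comp hr hr'⟩

@[fun_prop] theorem pair {f : γ → α} {g : γ → β} (hf : PolyTime f) (hg : PolyTime g) :
    PolyTime fun x => (f x, g x) := by
  obtain ⟨p, B, hB, hp⟩ := polyTime_iff.1 hf
  obtain ⟨q, B', hB', hq⟩ := polyTime_iff.1 hg
  refine polyTime_iff.2 ⟨.pair p q, fun x => B x + B' x + esize x, (hB.add hB').add .size,
    fun x => ?_⟩
  obtain ⟨t, ht, hr⟩ := hp x
  obtain ⟨t', ht', hr'⟩ := hq x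
  exact ⟨_, Nat.add_le_add (Nat.add_le_add ht ht') le_rfl, .pair hr hr'⟩

theorem constData (d : Data) : ∃ (p : Prog) (P : ℕ[X]), ∀ x : Data, ∃ t,
    t ≤ P.eval x.numLeaves ∧ p.Runs x d t := by
  induction d with
  | nil => exact ⟨.nil, X, fun x => ⟨_, by simp, .nil _⟩⟩
  | node u l r hl hr =>
    obtain ⟨p, P, hp⟩ := hl
    obtain ⟨q, Q, hq⟩ := hr
    refine ⟨.pair p q, P + Q + X, fun x => ?_⟩
    obtain ⟨t, ht, h⟩ := hp x
    obtain ⟨t', ht', h'⟩ := hq x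
    exact ⟨_, by simp only [eval_add, eval_X]; omega, .pair h h'⟩

@[fun_prop] theorem const (b : β) : PolyTime fun _ : α => b :=
  let ⟨p, P, h⟩ := constData (enc b)
  ⟨p, P, fun x => h (enc x)⟩

theorem fst' : PolyTime (fun x : α × β => x.1) :=
  ⟨.left, X, fun x => ⟨_, by simp [esize], .left _⟩⟩

theorem snd' : PolyTime (fun x : α × β => x.2) :=
  ⟨.right, X, fun x => ⟨_, by simp [esize], .right _⟩⟩

@[fun_prop] theorem fst {f : γ → α × β} (hf : PolyTime f) : PolyTime fun x => (f x).1 :=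
  comp fst' hf

@[fun_prop] theorem snd {f : γ → α × β} (hf : PolyTime f) : PolyTime fun x => (f x).2 :=
  comp snd' hf

@[fun_prop] theorem val {p : α → Prop} {f : γ → Subtype p} (hf : PolyTime f) :
    PolyTime fun x => (f x).1 :=
  hf.of_enc_eq fun _ => rfl

@[fun_prop] theorem beq [BEq α] [LawfulBEq α] {f g : γ → α} (hf : PolyTime f)
    (hg : PolyTime g) : PolyTime fun x => f x == g x := by
  have h : PolyTime (fun p : α × α => p.1 == p.2) := by
    refine ⟨.eq, X + 1, fun x => ⟨(enc x).numLeaves + 1, by simp [esize], ?_⟩⟩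
    have key : enc (x.1 == x.2)
        = if (enc x).left = (enc x).right then .node () .nil .nil else .nil := by
      by_cases hx : x.1 = x.2
      · rw [if_pos (show (enc x).left = (enc x).right from congrArg enc hx), hx,
          beq_self_eq_true]; rfl
      · rw [if_neg (show ¬(enc x).left = (enc x).right from fun h => hx (Enc.inj h)),
          beq_false_of_ne hx]; rfl
    rw [key]
    exact .eq _
  exact comp h (pair hf hg)

/-- Case distinction on a tree being `nil`, which serves `cond` and emptiness of lists. -/
theorem condEnc {c : γ → δ} {b : γ → Bool} {f g : γ → α} (hc : PolyTime c)
    (hb : ∀ x, b x = false ↔ enc (c x) = .nil) (hf : PolyTime f) (hg : PolyTime g) :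
    PolyTime fun x => cond (b x) (f x) (g x) := by
  obtain ⟨r, B, hB, hr⟩ := polyTime_iff.1 hc
  obtain ⟨p, B', hB', hp⟩ := polyTime_iff.1 hf
  obtain ⟨q, B'', hB'', hq⟩ := polyTime_iff.1 hg
  refine polyTime_iff.2 ⟨.cond r p q, fun x => B x + B' x + B'' x + esize x,
    ((hB.add hB').add hB'').add .size, fun x => ?_⟩
  obtain ⟨s, hs, h⟩ := hr x
  obtain ⟨t, ht, h'⟩ := hp x
  obtain ⟨t', ht', h''⟩ := hq x
  cases hbx : b x with
  | true =>
    refine ⟨_, ?_, .cond_true h (fun hn => ?_) h'⟩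
    · change _ + esize x ≤ B x + B' x + B'' x + esize x; omega
    · rw [← hb, hbx] at hn; exact Bool.noConfusion hn
  | false =>
    rw [(hb x).1 hbx] at h
    refine ⟨_, ?_, .cond_false h h''⟩
    change _ + esize x ≤ B x + B' x + B'' x + esize x; omega

@[fun_prop] theorem cond {c : γ → Bool} {f g : γ → α} (hc : PolyTime c) (hf : PolyTime f)
    (hg : PolyTime g) : PolyTime fun x => cond (c x) (f x) (g x) :=
  condEnc hc (fun x => by cases c x <;> simp [enc_true, enc_false]) hf hg

@[fun_prop] theorem not {f : γ → Bool} (hf : PolyTime f) : PolyTime fun x => !f x :=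
  (cond hf (const false) (const true)).of_enc_eq fun x => by cases f x <;> rfl

@[fun_prop] theorem and {f g : γ → Bool} (hf : PolyTime f) (hg : PolyTime g) :
    PolyTime fun x => f x && g x :=
  (cond hf hg (const false)).of_enc_eq fun x => by cases f x <;> rfl

@[fun_prop] theorem cons {f : γ → α} {l : γ → List α} (hf : PolyTime f) (hl : PolyTime l) :
    PolyTime fun x => f x :: l x :=
  (pair hf hl).of_enc_eq fun _ => rfl

@[fun_prop] theorem tail {l : γ → List α} (hl : PolyTime l) : PolyTime fun x => (l x).tail := by
  have h : PolyTime (fun l : List α => l.tail) :=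
    ⟨.right, X, fun l => ⟨(enc l).numLeaves, by simp [esize], by
      have : enc l.tail = (enc l).right := by cases l <;> rfl
      rw [this]; exact .right _⟩⟩
  exact comp h hl

@[fun_prop] theorem isEmpty {l : γ → List α} (hl : PolyTime l) :
    PolyTime fun x => (l x).isEmpty :=
  (condEnc (b := fun x => !(l x).isEmpty) hl (fun x => by
    cases l x <;> simp [enc_nil, enc_cons]) (const false) (const true)).of_enc_eq
      fun x => by cases (l x).isEmpty <;> rfl

@[fun_prop] theorem headD {l : γ → List α} {d : γ → α} (hl : PolyTime l) (hd : PolyTime d) :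
    PolyTime fun x => (l x).headD (d x) := by
  have h : PolyTime (fun p : α × List α => p.2.headD p.1) := by
    obtain ⟨p, P, hp⟩ := fst' (α := α) (β := List α)
    refine ⟨.cond .right (.comp .left .right) .left, 8 * X, fun x => ?_⟩
    obtain ⟨d, l⟩ := x
    cases l with
    | nil =>
      refine ⟨_, ?_, .cond_false (.right _) (.left _)⟩
      simp only [esize, eval_mul, eval_X, eval_ofNat]; omega
    | cons a l =>
      refine ⟨_, ?_, .cond_true (.right _) ?_ (.comp (.right _) (.left _))⟩
      · simp only [esize, eval_mul, eval_X, eval_ofNat, enc_pair, enc_cons, BinaryTree.numLeaves,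
          BinaryTree.right]
        omega
      · simp [enc_pair, enc_cons, BinaryTree.right]
  exact comp h (pair hd hl)

@[fun_prop] theorem succ {f : γ → ℕ} (hf : PolyTime f) : PolyTime fun x => f x + 1 :=
  (pair (const ()) hf).of_enc_eq fun _ => rfl

end PolyTime

end

/-! ### Iteration over lists in polynomial time -/

namespace PolyTime

variable {α β γ σ δ : Type} [Enc α] [Enc β] [Enc γ] [Enc σ] [Enc δ]

/-- One pass of the loop that computes a fold: the loop runs on triples `(x, s, l)`, of the
parameters, the state, and the part of the list that is still to be processed. -/
theorem exists_foldl_body {step : γ → σ → α → σ}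
    (hs : PolyTime fun p : γ × σ × α => step p.1 p.2.1 p.2.2) :
    ∃ (p : Prog) (P : ℕ[X]), ∀ x s a (l : List α), ∃ t,
      t ≤ P.eval (esize (x, s, a :: l)) ∧
        p.Runs (enc (x, s, a :: l)) (enc (x, step x s a, l)) t := by
  obtain ⟨p, P, hp⟩ := hs
  refine ⟨.pair .left (.pair (.comp p (.pair .left (.pair (.comp .left .right)
    (.comp .left (.comp .right .right))))) (.comp .right (.comp .right .right))),
    P + 30 * X, fun x s a l => ?_⟩
  obtain ⟨t, ht, h⟩ := hp (x, s, a)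
  have hle : P.eval (esize (x, s, a)) ≤ P.eval (esize (x, s, a :: l)) :=
    eval_mono P (by simp)
  refine ⟨_, ?_, .pair (.left _) (.pair (.comp (.pair (.left _) (.pair (.comp (.right _)
    (.left _)) (.comp (.comp (.right _) (.right _)) (.left _)))) h)
    (.comp (.comp (.right _) (.right _)) (.right _)))⟩
  simp only [esize, eval_add, eval_mul, eval_X, eval_ofNat, enc_pair, enc_cons,
    BinaryTree.numLeaves, BinaryTree.right] at ht hle ⊢
  omega

/-- A fold is computed in polynomial time if the step is, and if the states that occur have
polynomial size. -/
theorem foldl {step : γ → σ → α → σ} {init : γ → σ} {l : γ → List α}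
    (hs : PolyTime fun p : γ × σ × α => step p.1 p.2.1 p.2.2)
    (hi : PolyTime init) (hl : PolyTime l) {S : γ → ℕ} (hS : PolyBdd S)
    (hb : ∀ x l', l' <+: l x → esize (l'.foldl (step x) (init x)) ≤ S x) :
    PolyTime fun x => (l x).foldl (step x) (init x) := by
  obtain ⟨p, P, hp⟩ := exists_foldl_body hs
  -- Every pass costs at most a polynomial in `M`, a bound for the sizes of all triples.
  have loop : ∀ x (l : List α) (s : σ) (M : ℕ),
      (∀ l', l' <+: l → esize x + esize (l'.foldl (step x) s) + esize l ≤ M) →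
      ∃ t ≤ (l.length + 1) * (P.eval M + 10 * M),
        (Prog.loop (.comp .right .right) p).Runs (enc (x, s, l))
          (enc (x, l.foldl (step x) s, ([] : List α))) t := by
    intro x l
    induction l with
    | nil =>
      intro s M hM
      have := hM [] List.prefix_rfl
      refine ⟨_, ?_, .loop_done (.comp (.right _) (.right _))⟩
      simp only [esize, enc_pair, enc_nil, List.foldl_nil, List.length_nil,
        BinaryTree.numLeaves, BinaryTree.right] at this ⊢
      omega
    | cons a l ih =>
      intro s M hM
      obtain ⟨t, ht, h⟩ := hp x s a l
      have h0 := hM [] (List.nil_prefix)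
      rw [List.foldl_nil] at h0
      obtain ⟨t', ht', h'⟩ := ih (step x s a) M fun l' hl' => by
        have h1 := hM (a :: l') ((List.prefix_cons_inj a).2 hl')
        rw [List.foldl_cons, esize_cons] at h1
        omega
      refine ⟨_, ?_, .loop_step (.comp (.right _) (.right _)) ?_ h h'⟩
      · have h2 : P.eval (esize (x, s, a :: l)) ≤ P.eval M :=
          eval_mono P (by simp only [esize_pair]; omega)
        simp only [esize, enc_pair, enc_cons, List.length_cons, BinaryTree.numLeaves,
          BinaryTree.right] at h0 ht h2 ⊢
        rw [Nat.succ_mul (l.length + 1)]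
        omega
      · simp [enc_pair, enc_cons, BinaryTree.right]
  have hprog : PolyTime fun x => (x, (l x).foldl (step x) (init x), ([] : List α)) := by
    -- The loop is only run on triples that arise from some `x`: for others nothing is known about
    -- the size of the states.
    refine comp (f := fun y : {y : γ × σ × List α // ∃ x, y = (x, init x, l x)} =>
      (y.1.1, y.1.2.2.foldl (step y.1.1) y.1.2.1, ([] : List α)))
      (g := fun x => ⟨(x, init x, l x), x, rfl⟩) ?_ ((pair id (pair hi hl)).of_enc_eq fun _ => rfl)
    obtain ⟨Q, hQ⟩ := hS
    refine polyTime_iff.2 ⟨.loop (.comp .right .right) p, fun y => esize y *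
      (P.eval (esize y + Q.eval (esize y)) + 10 * (esize y + Q.eval (esize y))), ?_, ?_⟩
    · exact .mul .size (.add (.eval P (.add .size (.eval Q .size)))
        (.mul (.const 10) (.add .size (.eval Q .size))))
    · rintro ⟨_, x, rfl⟩
      change ∃ t ≤ (esize x + (esize (init x) + esize (l x))) * (P.eval (esize x +
        (esize (init x) + esize (l x)) + Q.eval (esize x + (esize (init x) + esize (l x)))) +
        10 * (esize x + (esize (init x) + esize (l x)) +
        Q.eval (esize x + (esize (init x) + esize (l x))))), _
      obtain ⟨t, ht, h⟩ := loop x (l x) (init x)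
        (esize x + (esize (init x) + esize (l x)) +
          Q.eval (esize x + (esize (init x) + esize (l x)))) fun l' hl' => by
        have h1 := hb x l' hl'
        have h2 := hQ x
        have h3 : Q.eval (esize x) ≤ Q.eval (esize x + (esize (init x) + esize (l x))) :=
          eval_mono Q (by omega)
        omega
      refine ⟨t, ht.trans (Nat.mul_le_mul_right _ ?_), h⟩
      have := length_lt_esize (l x)
      omega
  exact fst (snd hprog)

theorem foldl_cons_eq {α β : Type} (f : α → β) (l : List α) (acc : List β) :
    l.foldl (fun acc a => f a :: acc) acc = (l.map f).reverse ++ acc := by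
  induction l generalizing acc with
  | nil => rfl
  | cons a l ih => simp [ih]

theorem esize_reverse (l : List α) : esize l.reverse = esize l := by
  induction l with
  | nil => rfl
  | cons a l ih =>
    have := esize_append l.reverse [a]
    rw [List.reverse_cons]
    simp only [esize_cons, esize_nil] at this ⊢
    omega

@[fun_prop] theorem reverse {l : γ → List α} (hl : PolyTime l) :
    PolyTime fun x => (l x).reverse := by
  have h : PolyTime fun x => (l x).foldl (fun acc a => a :: acc) [] := by
    refine foldl (step := fun _ acc a => a :: acc) (by fun_prop) (by fun_prop) hl hl.polyBdd ?_
    intro x l' hl'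
    rw [foldl_cons_eq (fun a => a), List.append_nil, esize_reverse, List.map_id']
    exact esize_le_of_prefix hl'
  exact h.of_enc_eq fun x => by rw [foldl_cons_eq (fun a => a)]; simp

@[fun_prop] theorem map {f : γ → α → β} {l : γ → List α}
    (hf : PolyTime fun p : γ × α => f p.1 p.2) (hl : PolyTime l) :
    PolyTime fun x => (l x).map fun a => f x a := by
  obtain ⟨P, hP⟩ := hf.exists_bound
  have h : PolyTime fun x => (l x).foldl (fun acc a => f x a :: acc) [] := by
    refine foldl (step := fun x acc a => f x a :: acc) (by fun_prop) (by fun_prop) hl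
      (S := fun x => esize (l x) * P.eval (esize x + esize (l x)) + 1)
      (.add (.mul hl.polyBdd (.eval P (.add .size hl.polyBdd))) (.const 1)) ?_
    intro x l' hl'
    rw [foldl_cons_eq (f x), List.append_nil, esize_reverse]
    refine (esize_list_le (s := P.eval (esize x + esize (l x))) fun b hb => ?_).trans ?_
    · obtain ⟨a, ha, rfl⟩ := List.mem_map.1 hb
      exact (hP x a).trans (eval_mono P (Nat.add_le_add_left
        (esize_le_of_mem (hl'.subset ha)) _))
    · have h1 := hl'.length_le
      have h2 := length_lt_esize (l x)
      rw [List.length_map]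
      gcongr
      omega
  exact (reverse h).of_enc_eq fun x => by rw [foldl_cons_eq (f x)]; simp

@[fun_prop] theorem append {l l' : γ → List α} (hl : PolyTime l) (hl' : PolyTime l') :
    PolyTime fun x => l x ++ l' x := by
  have h : PolyTime fun x => (l x).reverse.foldl (fun acc a => a :: acc) (l' x) := by
    refine foldl (step := fun _ acc a => a :: acc) (by fun_prop) hl' (by fun_prop)
      (S := fun x => esize (l x) + esize (l' x)) (.add hl.polyBdd hl'.polyBdd) ?_
    intro x r hr
    rw [foldl_cons_eq (fun a => a), List.map_id']
    have h1 := esize_append r.reverse (l' x)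
    have h2 := esize_le_of_prefix hr
    rw [esize_reverse] at h1 h2
    omega
  exact h.of_enc_eq fun x => by rw [foldl_cons_eq (fun a => a)]; simp

@[fun_prop] theorem flatten {l : γ → List (List α)} (hl : PolyTime l) :
    PolyTime fun x => (l x).flatten := by
  have key : ∀ (l : List (List α)) acc, l.foldl (fun acc a => acc ++ a) acc = acc ++ l.flatten := by
    intro l
    induction l with
    | nil => simp
    | cons a l ih => intro acc; rw [List.foldl_cons, ih]; simp
  have hsize : ∀ l : List (List α), esize l.flatten ≤ esize l := by
    intro l
    induction l with
    | nil => simp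
    | cons a l ih =>
      have := esize_append a l.flatten
      rw [List.flatten_cons, esize_cons]; omega
  have h : PolyTime fun x => (l x).foldl (fun acc a => acc ++ a) [] := by
    refine foldl (step := fun _ acc a => acc ++ a) (by fun_prop) (by fun_prop) hl hl.polyBdd ?_
    intro x r hr
    rw [key, List.nil_append]
    exact (hsize r).trans (esize_le_of_prefix hr)
  exact h.of_enc_eq fun x => by rw [key, List.nil_append]

@[fun_prop] theorem flatMap {f : γ → α → List β} {l : γ → List α}
    (hf : PolyTime fun p : γ × α => f p.1 p.2) (hl : PolyTime l) :
    PolyTime fun x => (l x).flatMap fun a => f x a :=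
  (flatten (map hf hl)).of_enc_eq fun x => by rw [List.flatMap_def]

@[fun_prop] theorem filter {p : γ → α → Bool} {l : γ → List α}
    (hp : PolyTime fun q : γ × α => p q.1 q.2) (hl : PolyTime l) :
    PolyTime fun x => (l x).filter fun a => p x a :=
  (flatMap (f := fun x a => bif p x a then [a] else []) (by fun_prop) hl).of_enc_eq fun x => by
    congr 1
    induction l x with
    | nil => rfl
    | cons a l ih => rw [List.filter_cons, List.flatMap_cons, ← ih]; cases p x a <;> rfl

@[fun_prop] theorem any {p : γ → α → Bool} {l : γ → List α}
    (hp : PolyTime fun q : γ × α => p q.1 q.2) (hl : PolyTime l) :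
    PolyTime fun x => (l x).any fun a => p x a :=
  (not (isEmpty (filter hp hl))).of_enc_eq fun x => by
    congr 1
    induction l x with
    | nil => rfl
    | cons a l ih => rw [List.any_cons, ih, List.filter_cons]; cases p x a <;> rfl

@[fun_prop] theorem all {p : γ → α → Bool} {l : γ → List α}
    (hp : PolyTime fun q : γ × α => p q.1 q.2) (hl : PolyTime l) :
    PolyTime fun x => (l x).all fun a => p x a :=
  (not (any (p := fun x a => !p x a) (not hp) hl)).of_enc_eq fun x => by
    congr 1
    rw [List.not_any_eq_all_not]; simp only [Bool.not_not]

@[fun_prop] theorem contains [BEq α] [LawfulBEq α] {l : γ → List α} {a : γ → α}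
    (hl : PolyTime l) (ha : PolyTime a) : PolyTime fun x => (l x).contains (a x) :=
  (any (p := fun x b => a x == b) (by fun_prop) hl).of_enc_eq fun x => by
    rw [List.contains_eq_any_beq]

@[fun_prop] theorem length {l : γ → List α} (hl : PolyTime l) :
    PolyTime fun x => (l x).length :=
  (map (f := fun _ _ => ()) (by fun_prop) hl).of_enc_eq fun x => by
    change encodeList _ = encodeList _
    simp [enc]

/-- A number in unary is a list of units. -/
theorem replicateUnit {f : γ → ℕ} (hf : PolyTime f) :
    PolyTime fun x => List.replicate (f x) () :=
  hf.of_enc_eq fun x => by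
    change encodeList _ = encodeList _
    simp [enc]

@[fun_prop] theorem range {f : γ → ℕ} (hf : PolyTime f) : PolyTime fun x => List.range (f x) := by
  have key : ∀ n, (List.replicate n ()).foldl (fun acc _ => acc ++ [acc.length]) []
      = List.range n := by
    intro n
    induction n with
    | zero => rfl
    | succ n ih =>
      rw [List.replicate_succ', List.foldl_append, ih, List.foldl_cons, List.foldl_nil,
        List.length_range, List.range_succ]
  have h : PolyTime fun x =>
      (List.replicate (f x) ()).foldl (fun acc _ => acc ++ [acc.length]) [] := by
    refine foldl (step := fun _ acc _ => acc ++ [acc.length]) (by fun_prop) (by fun_prop)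
      (replicateUnit hf) (S := fun x => esize (f x) * esize (f x) + 1)
      (.add (.mul hf.polyBdd hf.polyBdd) (.const 1)) ?_
    intro x r hr
    have hlen := hr.length_le
    rw [List.eq_replicate_of_mem (l := r) (a := ()) fun _ _ => rfl, key]
    rw [List.length_replicate] at hlen
    refine (esize_list_le (s := esize (f x)) fun b hb => ?_).trans ?_
    · rw [List.mem_range] at hb
      simp only [esize_nat]; omega
    · rw [List.length_range, esize_nat]
      gcongr
      omega
  exact h.of_enc_eq fun x => by rw [key]

@[fun_prop] theorem zip [Inhabited β] {l : γ → List α} {l' : γ → List β} (hl : PolyTime l)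
    (hl' : PolyTime l') : PolyTime fun x => (l x).zip (l' x) := by
  let step : List (α × β) × List β → α → List (α × β) × List β := fun s a =>
    bif s.2.isEmpty then s else ((a, s.2.headD default) :: s.1, s.2.tail)
  have key : ∀ (l : List α) (l' : List β) acc,
      l.foldl step (acc, l') = ((l.zip l').reverse ++ acc, l'.drop l.length) := by
    intro l
    induction l with
    | nil => simp
    | cons a l ih =>
      intro l' acc
      cases l' with
      | nil => simpa [step] using ih [] acc
      | cons b l' =>
        have : step (acc, b :: l') a = ((a, b) :: acc, l') := rfl
        rw [List.foldl_cons, this, ih]; simp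
  have hsize : ∀ (l : List α) (l' : List β), esize (l.zip l') ≤ esize l + esize l' := by
    intro l
    induction l with
    | nil => simp
    | cons a l ih =>
      intro l'
      cases l' with
      | nil => simp
      | cons b l' => have := ih l'; simp only [List.zip_cons_cons, esize_cons, esize_pair]; omega
  have h : PolyTime fun x => (l x).foldl step ([], l' x) := by
    refine foldl (step := fun _ => step) (by fun_prop) (by fun_prop) hl
      (S := fun x => esize (l x) + esize (l' x) + esize (l' x))
      (.add (.add hl.polyBdd hl'.polyBdd) hl'.polyBdd) ?_
    intro x r hr
    rw [key, List.append_nil, esize_pair, esize_reverse]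
    have h1 := hsize r (l' x)
    have h2 := esize_le_of_prefix hr
    have h3 := esize_append ((l' x).take r.length) ((l' x).drop r.length)
    have h4 := one_le_esize ((l' x).take r.length)
    rw [List.take_append_drop] at h3
    omega
  exact (reverse (fst h)).of_enc_eq fun x => by rw [key]; simp

@[fun_prop] theorem add {f g : γ → ℕ} (hf : PolyTime f) (hg : PolyTime g) :
    PolyTime fun x => f x + g x :=
  (length (append (range hf) (range hg))).of_enc_eq fun x => by simp

@[fun_prop] theorem mul {f g : γ → ℕ} (hf : PolyTime f) (hg : PolyTime g) :
    PolyTime fun x => f x * g x :=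
  (length (flatMap (f := fun x _ => List.range (g x)) (by fun_prop) (range hf))).of_enc_eq
    fun x => by simp

@[fun_prop] theorem lt {f g : γ → ℕ} (hf : PolyTime f) (hg : PolyTime g) :
    PolyTime fun x => decide (f x < g x) :=
  (contains (range hg) hf).of_enc_eq fun x => by
    congr 1
    rw [Bool.eq_iff_iff]; simp

@[fun_prop] theorem le {f g : γ → ℕ} (hf : PolyTime f) (hg : PolyTime g) :
    PolyTime fun x => decide (f x ≤ g x) :=
  (lt hf (succ hg)).of_enc_eq fun x => by simp only [Nat.lt_succ_iff]

end PolyTime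

/-! ### The ingredients of the construction -/

/-- `⌊n / k⌋`, by counting the multiples of `k`. -/
def quot (n k : ℕ) : ℕ := ((List.range n).filter fun i => decide ((i + 1) * k ≤ n)).length

/-- The members of the bin `j`. -/
def members {α : Type} (acc : List (α × ℕ)) (j : ℕ) : List α :=
  (acc.filter fun p => p.2 == j).map fun p => p.1

/-- The bin of the item `a`; the bin `0` if `a` is not in any bin. -/
def binOf {α : Type} [BEq α] [Inhabited α] (acc : List (α × ℕ)) (a : α) : ℕ :=
  ((acc.filter fun p => p.1 == a).headD default).2

section greedy

variable {α : Type} (conf : α → α → Bool) (cap B : ℕ)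

/-- The first of the bins `0, …, B - 1` that contains fewer than `cap` items and none in conflict
with `a`; the bin `0` if there is none. -/
def firstBin (acc : List (α × ℕ)) (a : α) : ℕ :=
  ((List.range B).filter fun j =>
    decide ((members acc j).length < cap) && (members acc j).all fun a' => !conf a a').headD 0

/-- The items are put into bins one after another, each into the first bin that is
admissible. -/
def greedy (items : List α) : List (α × ℕ) :=
  items.foldl (fun acc a => acc ++ [(a, firstBin conf cap B acc a)]) []

end greedy

/-- The largest `k` with `16 ^ (k - 1) ≤ b`, for `1 ≤ b`. The first component of the state is
the power of `16` reached. -/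
def depth (b : ℕ) : ℕ :=
  ((List.range b).foldl (fun s _ => bif decide (s.1 * 16 ≤ b) then (s.1 * 16, s.2 + 1) else s)
    (1, 1)).2

/-- All Boolean vectors of length `k`. -/
def boolVecs (k : ℕ) : List (List Bool) :=
  (List.range k).foldl (fun acc _ => acc.flatMap fun v => [true :: v, false :: v]) [[]]

/-- The rows of the identity matrix of order `N`. -/
def unitRows (N : ℕ) : List (List Bool) :=
  (List.range N).map fun p => (List.range N).map fun q => p == q

/-- One step in the construction of detecting matrices. The new matrix has four rows and four
columns for every row and column of the old one, arranged in blocks with the old matrix outside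
of the diagonal and zeros on the diagonal, and moreover one new column for every row of
the old matrix, with a one in the first of the corresponding four rows. -/
def detectStep (M : List (List Bool)) : List (List Bool) :=
  (List.range 4).flatMap fun d => (M.zip (unitRows M.length)).map fun r =>
    ((List.range 4).flatMap fun i => bif i == d then r.1.map (fun _ => false) else r.1) ++
      bif d == 0 then r.2 else r.2.map fun _ => false

/-- A matrix with `4 ^ k` rows and `k * 4 ^ (k - 1)` columns. -/
def detectRows (k : ℕ) : List (List Bool) :=
  (List.range k).foldl (fun M _ => detectStep M) [[]]

/-- The entries of `l` at the positions where `r` has the entry `s`. -/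
def select {α : Type} (l : List α) (r : List Bool) (s : Bool) : List α :=
  ((l.zip r).filter fun q => q.2 == s).map fun q => q.1

/-- Clauses over the variables `0, 1, 2, …`. -/
abbrev NatClause := List (ℕ × Bool)

/-- The inputs: the number `n` of variables, the number `b`, and the clauses (and an end marker);
only (3,4)-SAT instances with `2 ≤ b ≤ n` are considered. -/
abbrev Input := {x : ℕ × ℕ × List NatClause × Unit //
  2 ≤ x.2.1 ∧ x.2.1 ≤ x.1 ∧
  (∀ c ∈ x.2.2.1, c.length = 3 ∧ (c.map Prod.fst).Nodup ∧ ∀ l ∈ c, l.1 < x.1) ∧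
  ∀ v < x.1, x.2.2.1.countP (fun c => (c.map Prod.fst).contains v) ≤ 4}

/-- A color consists of a slot and the values of the variables of a group. -/
abbrev Color := ℕ × List Bool

/-- A vertex of the graph under construction: its class in the 3-coloring, an identifying
number, the groups of clauses it is concerned with, its list of colors, and its demand. -/
abbrev Vertex := ℕ × ℕ × List ℕ × List Color × ℕ

/-- Two vertices are adjacent if they belong to different classes and a group of clauses
concerns both. -/
def vertexAdj (u v : Vertex) : Bool :=
  !(u.1 == v.1) && u.2.2.1.any fun j => v.2.2.1.contains j

namespace Input

variable (x : Input)

/-- The number of variables of the formula. -/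
def numVars : ℕ := x.1.1

/-- The clauses of the formula. -/
def clauses : List NatClause := x.1.2.2.1

/-- The maximal number of variables in a group, which is also the depth of the detecting
matrix. It is about a quarter of `log₂ b`. -/
def groupSize : ℕ := depth x.1.2.1

/-- The possible values of the variables of a group. -/
def vecs : List (List Bool) := boolVecs x.groupSize

/-- The rows of the detecting matrix. -/
def rows : List (List Bool) := detectRows x.groupSize

/-- The number of columns of the detecting matrix, which is the maximal number of clauses in a
group. -/
def width : ℕ := (x.rows.headD []).length

/-- The number of groups of variables. A variable is in conflict with at most `12` others, as it
occurs in at most four clauses. -/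
def numVarGroups : ℕ := quot x.numVars x.groupSize + 13

/-- Two variables are in conflict if they occur in a common clause. -/
def varConf (v w : ℕ) : Bool :=
  x.clauses.any fun c => (c.map fun l => l.1).contains v && (c.map fun l => l.1).contains w

/-- The distribution of the variables into groups; no clause has two variables of one group. -/
def varBins : List (ℕ × ℕ) :=
  greedy x.varConf x.groupSize x.numVarGroups (List.range x.numVars)

/-- The group of the variable `v`. -/
def groupOf (v : ℕ) : ℕ := binOf x.varBins v

/-- The number of groups of clauses. A clause is in conflict with at most `12 * k` others, where
`k` is the group size: three groups of `k` variables, each in four clauses. -/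
def numClauseGroups : ℕ := quot x.clauses.length x.width + (12 * x.groupSize + 1)

/-- Two clauses are in conflict if a group of variables occurs in both. -/
def clauseConf (c c' : NatClause) : Bool :=
  c.any fun l => c'.any fun l' => x.groupOf l.1 == x.groupOf l'.1

/-- The distribution of the clauses into groups; the literals of all clauses of a group have
variables from different groups of variables. -/
def clauseBins : List (NatClause × ℕ) :=
  greedy x.clauseConf x.width x.numClauseGroups x.clauses

/-- The clauses of the group `j`. -/
def group (j : ℕ) : List NatClause := members x.clauseBins j

/-- The groups of clauses in which variables of the group `i` occur. -/
def touch (i : ℕ) : List ℕ :=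
  (List.range x.numClauseGroups).filter fun j =>
    ((x.group j).flatten.map fun l => x.groupOf l.1).contains i

/-- The number of slots, one more than the number of groups of variables with which a group of
variables can be in conflict: it occurs in at most `4 * k` groups of clauses, each with at most
`3 * width` literals. -/
def numSlots : ℕ := 12 * x.groupSize * x.width + 1

/-- Two groups of variables are in conflict if they occur in a common group of clauses. -/
def slotConf (i i' : ℕ) : Bool := (x.touch i).any fun j => (x.touch i').contains j

/-- The distribution of the groups of variables into slots, such that groups of variables that
occur in the same group of clauses have different slots. The capacity of the slots is no
restriction. -/
def slotBins : List (ℕ × ℕ) :=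
  greedy x.slotConf (x.numVarGroups + 1) x.numSlots (List.range x.numVarGroups)

/-- The slot of the group `i` of variables. -/
def slot (i : ℕ) : ℕ := binOf x.slotBins i

/-- The colors of the group of the variable of `l`. -/
def litColors (l : ℕ × Bool) : List Color := x.vecs.map fun τ => (x.slot (x.groupOf l.1), τ)

/-- The colors of the group of the variable of `l` that stand for assignments satisfying `l`. -/
def satColors (l : ℕ × Bool) : List Color :=
  (x.vecs.filter fun τ => ((members x.varBins (x.groupOf l.1)).zip τ).contains l).map
    fun τ => (x.slot (x.groupOf l.1), τ)

/-- All colors. -/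
def palette : List Color :=
  (List.range x.numSlots).flatMap fun s => x.vecs.map fun τ => (s, τ)

/-- All but one of the colors of a group of variables are used at its vertex; the remaining
one is the assignment. -/
def varVertex (i : ℕ) : Vertex :=
  (0, i, x.touch i, x.vecs.map (fun τ => (x.slot i, τ)), x.vecs.tail.length)

/-- Selects as many true literals as there are clauses in the group. -/
def selVertex (j : ℕ) : Vertex :=
  (1, j, [j], (x.group j).flatten.flatMap x.satColors, (x.group j).length)

/-- Uses up the colors that stand for the assignment and are not selected. -/
def resVertex (j : ℕ) : Vertex :=
  (2, j, [j], (x.group j).flatten.flatMap x.litColors, 2 * (x.group j).length)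

/-- Checks that at least as many literals are selected as there are clauses, among the clauses
of the group `j` where the row `r` has the entry `s`. -/
def rowVertex (j : ℕ) (r : List Bool) (s : Bool) : Vertex :=
  (1, j, [j], (select (x.group j) r s).flatten.flatMap x.litColors,
    (select (x.group j) r s).length)

/-- All vertices, including those with demand zero. -/
def allVertices : List Vertex :=
  (List.range x.numVarGroups).map x.varVertex ++
    (List.range x.numClauseGroups).flatMap fun j =>
      x.selVertex j :: x.resVertex j ::
        x.rows.flatMap fun r => [x.rowVertex j r true, x.rowVertex j r false]

def vertices : List Vertex := x.allVertices.filter fun v => !(v.2.2.2.2 == 0)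

/-- The parts of the output: number of colors, bound for the demands, number of vertices,
adjacency matrix, characteristic vectors of the lists, demands, 3-coloring, end marker. -/
def output : ℕ × ℕ × ℕ × List (List Bool) × List (List Bool) × List ℕ × List ℕ × Unit :=
  (x.palette.length, 2 * x.1.2.1, x.vertices.length,
    x.vertices.map (fun u => x.vertices.map fun v => vertexAdj u v),
    x.vertices.map (fun u => x.palette.map fun c => u.2.2.2.1.contains c),
    x.vertices.map (fun u => u.2.2.2.2),
    x.vertices.map (fun u => u.1), ())

end Input

/-! ### The construction takes polynomial time -/

section

variable {α β γ : Type} [Enc α] [Enc β] [Enc γ]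

@[fun_prop] theorem PolyTime.quot {f g : γ → ℕ} (hf : PolyTime f) (hg : PolyTime g) :
    PolyTime fun x => quot (f x) (g x) := by
  unfold ListColoring.quot; fun_prop

@[fun_prop] theorem PolyTime.members {f : γ → List (α × ℕ)} {g : γ → ℕ} (hf : PolyTime f)
    (hg : PolyTime g) : PolyTime fun x => members (f x) (g x) := by
  unfold ListColoring.members; fun_prop

@[fun_prop] theorem PolyTime.binOf [BEq α] [LawfulBEq α] [Inhabited α] {f : γ → List (α × ℕ)}
    {g : γ → α} (hf : PolyTime f) (hg : PolyTime g) : PolyTime fun x => binOf (f x) (g x) := by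
  unfold ListColoring.binOf; fun_prop

theorem firstBin_le {α : Type} (conf : α → α → Bool) (cap B : ℕ) (acc : List (α × ℕ)) (a : α) :
    firstBin conf cap B acc a ≤ B := by
  unfold firstBin
  generalize hF : List.filter _ (List.range B) = F
  cases F with
  | nil => simp
  | cons j F =>
    have : j ∈ j :: F := List.mem_cons_self
    rw [← hF, List.mem_filter, List.mem_range] at this
    exact this.1.le

@[fun_prop] theorem PolyTime.firstBin {conf : γ → α → α → Bool} {cap B : γ → ℕ}
    {acc : γ → List (α × ℕ)} {a : γ → α}
    (hconf : PolyTime fun p : γ × α × α => conf p.1 p.2.1 p.2.2) (hcap : PolyTime cap)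
    (hB : PolyTime B) (hacc : PolyTime acc) (ha : PolyTime a) :
    PolyTime fun x => firstBin (fun a a' => conf x a a') (cap x) (B x) (acc x) (a x) := by
  have h : PolyTime fun q : (γ × ℕ) × α => !conf q.1.1 (a q.1.1) q.2 :=
    .not (.comp hconf (g := fun q : (γ × ℕ) × α => (q.1.1, a q.1.1, q.2)) (by fun_prop))
  unfold ListColoring.firstBin
  fun_prop

/-- The bins of the items of a prefix are numbers up to `B`, so that the states of the greedy
algorithm are small. -/
theorem esize_greedy_le (conf : α → α → Bool) (cap B : ℕ) (items : List α) :
    esize (greedy conf cap B items) ≤ esize items + items.length * (B + 1) := by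
  induction items using List.reverseRecOn with
  | nil => simp [greedy]
  | append_singleton l a ih =>
    unfold greedy at ih ⊢
    rw [List.foldl_append, List.foldl_cons, List.foldl_nil]
    generalize List.foldl _ [] l = acc at ih ⊢
    have h1 := esize_append acc [(a, ListColoring.firstBin conf cap B acc a)]
    have h2 := esize_append l [a]
    have h3 := firstBin_le conf cap B acc a
    simp only [esize_cons, esize_pair, esize_nil, esize_nat, List.length_append,
      List.length_singleton, Nat.succ_mul] at *
    omega

@[fun_prop] theorem PolyTime.greedy {conf : γ → α → α → Bool} {cap B : γ → ℕ}
    {items : γ → List α}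
    (hconf : PolyTime fun p : γ × α × α => conf p.1 p.2.1 p.2.2) (hcap : PolyTime cap)
    (hB : PolyTime B) (hi : PolyTime items) :
    PolyTime fun x => greedy (fun a a' => conf x a a') (cap x) (B x) (items x) := by
  have h : PolyTime fun p : γ × List (α × ℕ) × α =>
      ListColoring.firstBin (fun a a' => conf p.1 a a') (cap p.1) (B p.1) p.2.1 p.2.2 :=
    .firstBin (conf := fun p : γ × List (α × ℕ) × α => conf p.1)
      (.comp hconf (g := fun q : (γ × List (α × ℕ) × α) × α × α => (q.1.1, q.2)) (by fun_prop))
      (by fun_prop) (by fun_prop) (by fun_prop) (by fun_prop)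
  refine foldl (step := fun x acc a =>
    acc ++ [(a, ListColoring.firstBin (fun a a' => conf x a a') (cap x) (B x) acc a)])
    (by fun_prop) (by fun_prop) hi
    (S := fun x => esize (items x) + esize (items x) * (esize (B x)))
    (.add hi.polyBdd (.mul hi.polyBdd hB.polyBdd)) ?_
  intro x l hl
  refine (esize_greedy_le (conf x) (cap x) (B x) l).trans ?_
  rw [esize_nat]
  gcongr
  · exact esize_le_of_prefix hl
  · exact hl.length_le.trans (length_lt_esize _).le

@[fun_prop] theorem PolyTime.select {f : γ → List α} {g : γ → List Bool} {s : γ → Bool}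
    (hf : PolyTime f) (hg : PolyTime g) (hs : PolyTime s) :
    PolyTime fun x => select (f x) (g x) (s x) := by
  unfold ListColoring.select; fun_prop

@[fun_prop] theorem PolyTime.unitRows {f : γ → ℕ} (hf : PolyTime f) :
    PolyTime fun x => unitRows (f x) := by
  unfold ListColoring.unitRows; fun_prop

@[fun_prop] theorem PolyTime.detectStep {f : γ → List (List Bool)} (hf : PolyTime f) :
    PolyTime fun x => detectStep (f x) := by
  unfold ListColoring.detectStep; fun_prop

@[fun_prop] theorem PolyTime.vertexAdj {f g : γ → Vertex} (hf : PolyTime f) (hg : PolyTime g) :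
    PolyTime fun x => vertexAdj (f x) (g x) := by
  unfold ListColoring.vertexAdj; fun_prop

end

theorem foldl_range_succ {σ : Type} (f : σ → ℕ → σ) (s : σ) (k : ℕ) :
    (List.range (k + 1)).foldl f s = f ((List.range k).foldl f s) k := by
  rw [List.range_succ, List.foldl_append]; rfl

theorem boolVecs_succ (k : ℕ) :
    boolVecs (k + 1) = (boolVecs k).flatMap fun v => [true :: v, false :: v] :=
  foldl_range_succ ..

theorem mem_boolVecs {k : ℕ} {v : List Bool} : v ∈ boolVecs k ↔ v.length = k := by
  induction k generalizing v with
  | zero => simp [boolVecs]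
  | succ k ih =>
    rw [boolVecs_succ, List.mem_flatMap]
    constructor
    · rintro ⟨w, hw, h⟩
      rw [ih] at hw
      simp only [List.mem_cons, List.not_mem_nil, or_false] at h
      rcases h with rfl | rfl <;> simp [hw]
    · intro h
      cases v with
      | nil => simp at h
      | cons s v =>
        refine ⟨v, ih.2 (by simpa using h), ?_⟩
        cases s <;> simp

theorem length_boolVecs (k : ℕ) : (boolVecs k).length = 2 ^ k := by
  induction k with
  | zero => rfl
  | succ k ih =>
    rw [boolVecs_succ, List.length_flatMap, pow_succ, ← ih]
    simp

theorem nodup_boolVecs (k : ℕ) : (boolVecs k).Nodup := by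
  induction k with
  | zero => simp [boolVecs]
  | succ k ih =>
    rw [boolVecs_succ, List.nodup_flatMap]
    refine ⟨fun v _ => by simp, ih.imp fun {v w} hvw => ?_⟩
    simp only [Function.onFun, List.disjoint_left, List.mem_cons, List.not_mem_nil, or_false]
    rintro u (rfl | rfl) <;> simp [hvw]

theorem detectRows_succ (k : ℕ) : detectRows (k + 1) = detectStep (detectRows k) :=
  foldl_range_succ ..

theorem length_unitRows (N : ℕ) : (unitRows N).length = N := by simp [unitRows]

theorem length_detectRows (k : ℕ) : (detectRows k).length = 4 ^ k := by
  induction k with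
  | zero => rfl
  | succ k ih =>
    rw [detectRows_succ, detectStep, List.length_flatMap]
    simp only [List.length_map, List.length_zip, length_unitRows, min_self, ih]
    simp only [List.map_const', List.length_range, List.sum_replicate, smul_eq_mul]
    rw [pow_succ, mul_comm]

theorem length_of_mem_unitRows {N : ℕ} {r : List Bool} (hr : r ∈ unitRows N) : r.length = N := by
  obtain ⟨p, -, rfl⟩ := List.mem_map.1 hr
  simp

theorem length_of_mem_detectRows {k : ℕ} {r : List Bool} (hr : r ∈ detectRows k) :
    4 * r.length = k * 4 ^ k := by
  induction k generalizing r with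
  | zero => simp [detectRows] at hr; simp [hr]
  | succ k ih =>
    rw [detectRows_succ, detectStep, List.mem_flatMap] at hr
    obtain ⟨d, hd, hr⟩ := hr
    obtain ⟨⟨r, e⟩, hre, rfl⟩ := List.mem_map.1 hr
    have h1 := ih (List.of_mem_zip hre).1
    have h2 := length_of_mem_unitRows (List.of_mem_zip hre).2
    rw [length_detectRows] at h2
    have h3 : ∀ i : ℕ, (bif i == d then r.map (fun _ => false) else r).length = r.length := by
      intro i; cases i == d <;> simp
    have h4 : (bif d == 0 then e else e.map fun _ => false).length = e.length := by
      cases d == 0 <;> simp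
    rw [List.length_append, h4, h2, List.length_flatMap]
    simp only [h3]
    simp only [List.map_const', List.length_range, List.sum_replicate, smul_eq_mul]
    rw [pow_succ, mul_add, mul_left_comm, h1]
    ring

/-- The state of the computation of the depth after `i` steps. -/
theorem depth_state (b : ℕ) (hb : 1 ≤ b) (i : ℕ) :
    let s := (List.range i).foldl
      (fun s _ => bif decide (s.1 * 16 ≤ b) then (s.1 * 16, s.2 + 1) else s) (1, 1)
    1 ≤ s.2 ∧ s.1 = 16 ^ (s.2 - 1) ∧ s.1 ≤ b ∧ s.2 ≤ i + 1 ∧ (b < s.1 * 16 ∨ s.2 = i + 1) := by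
  induction i with
  | zero => simpa using hb
  | succ i ih =>
    rw [foldl_range_succ]
    generalize List.foldl _ _ (List.range i) = s at ih ⊢
    obtain ⟨p, k⟩ := s
    obtain ⟨h1, h2, h3, h4, h5⟩ := ih
    dsimp only at h1 h2 h3 h4 h5
    by_cases h : p * 16 ≤ b
    · simp only [h, decide_true, cond_true]
      refine ⟨by omega, ?_, trivial, by omega, by omega⟩
      rw [h2, ← pow_succ]
      congr 1; omega
    · simp only [h, decide_false, cond_false]
      refine ⟨h1, h2, h3, by omega, by omega⟩

theorem depth_spec {b : ℕ} (hb : 1 ≤ b) :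
    1 ≤ depth b ∧ 16 ^ (depth b - 1) ≤ b ∧ b < 16 ^ depth b := by
  obtain ⟨h1, h2, h3, -, h5⟩ := depth_state b hb b
  change 1 ≤ depth b at h1
  rw [h2] at h3 h5
  refine ⟨h1, h3, ?_⟩
  change b < 16 ^ (depth b - 1) * 16 ∨ depth b = b + 1 at h5
  rw [← pow_succ, Nat.sub_add_cancel h1] at h5
  rcases h5 with h5 | h5
  · exact h5
  · rw [h5]
    exact (Nat.lt_pow_self (by norm_num)).trans (Nat.pow_lt_pow_right (by norm_num) b.lt_succ_self)

@[fun_prop] theorem PolyTime.depth {γ : Type} [Enc γ] {f : γ → ℕ} (hf : PolyTime f) :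
    PolyTime fun x => depth (f x) := by
  unfold ListColoring.depth
  refine .snd (foldl (step := fun x s _ =>
    bif decide (s.1 * 16 ≤ f x) then (s.1 * 16, s.2 + 1) else s) (by fun_prop) (by fun_prop)
    (by fun_prop) (S := fun x => esize (f x) + esize (f x) + 10)
    (.add (.add hf.polyBdd hf.polyBdd) (.const _)) ?_)
  intro x l hl
  rcases Nat.eq_zero_or_pos (f x) with h0 | h0
  · rw [h0, List.range_zero, List.prefix_nil] at hl
    rw [hl, List.foldl_nil]
    simp only [esize_pair, esize_nat]; omega
  · rw [List.prefix_iff_eq_take.1 hl, List.take_range]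
    obtain ⟨h1, -, h3, h4, -⟩ := depth_state (f x) h0 (min l.length (f x))
    generalize List.foldl _ _ (List.range (min l.length (f x))) = s at h1 h3 h4 ⊢
    change esize s.1 + esize s.2 ≤ _
    simp only [esize_nat]
    omega

theorem le_two_pow_pred (k : ℕ) : k ≤ 2 ^ (k - 1) := by
  have := (k - 1).lt_two_pow_self
  omega

namespace Input

variable (x : Input)

theorem groupSize_spec : 1 ≤ x.groupSize ∧ 16 ^ (x.groupSize - 1) ≤ x.1.2.1 ∧
    x.1.2.1 < 16 ^ x.groupSize :=
  depth_spec (by have := x.2.1; omega)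

/-- All quantities in the construction are estimated by the number `q = 2 ^ (k - 1)`, where `k`
is the group size. -/
theorem exists_scale : ∃ q, 1 ≤ q ∧ q ^ 4 ≤ x.1.2.1 ∧ x.groupSize ≤ q ∧
    2 ^ x.groupSize = 2 * q ∧ 4 ^ x.groupSize = 4 * q ^ 2 := by
  obtain ⟨h1, h2, -⟩ := x.groupSize_spec
  refine ⟨2 ^ (x.groupSize - 1), Nat.one_le_two_pow, ?_, le_two_pow_pred _, ?_, ?_⟩
  · rwa [← pow_mul, mul_comm, pow_mul]
  · rw [← pow_succ', Nat.sub_add_cancel h1]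
  · obtain ⟨k, hk⟩ := Nat.exists_eq_add_of_le' h1
    rw [hk, Nat.add_sub_cancel, ← pow_mul, mul_comm k, pow_mul, pow_succ']
    norm_num

theorem exists_eq_range_of_prefix {k : ℕ} {l : List ℕ} (hl : l <+: List.range k) :
    ∃ i ≤ k, l = List.range i := by
  rw [List.prefix_iff_eq_take.1 hl, List.take_range]
  exact ⟨_, min_le_right _ _, rfl⟩

theorem esize_bools_le (v : List Bool) : esize v ≤ v.length * 2 + 1 :=
  esize_list_le fun s _ => esize_bool s

theorem two_pow_groupSize_le : 2 ^ x.groupSize ≤ 2 * x.1.2.1 := by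
  obtain ⟨q, h1, h2, -, h4, -⟩ := x.exists_scale
  have : q ≤ q ^ 4 := Nat.le_self_pow (by norm_num) q
  omega

theorem four_pow_groupSize_le : 4 ^ x.groupSize ≤ 4 * x.1.2.1 := by
  obtain ⟨q, h1, h2, -, -, h4⟩ := x.exists_scale
  have : q ^ 2 ≤ q ^ 4 := Nat.pow_le_pow_right h1 (by norm_num)
  omega

theorem groupSize_le : x.groupSize ≤ x.1.2.1 := by
  obtain ⟨q, h1, h2, h3, -⟩ := x.exists_scale
  have : q ≤ q ^ 4 := Nat.le_self_pow (by norm_num) q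
  omega

theorem polyBdd_b : PolyBdd fun x : Input => x.1.2.1 :=
  (PolyTime.polyBdd (f := fun x : Input => x.1.2.1) (by fun_prop)).mono fun x => by simp

theorem polyTime_groupSize : PolyTime fun x : Input => x.groupSize := by
  unfold groupSize; fun_prop

theorem polyTime_vecs : PolyTime fun x : Input => x.vecs := by
  have := polyTime_groupSize
  refine .foldl (γ := Input) (α := ℕ) (step := fun _ (acc : List (List Bool)) _ =>
    acc.flatMap fun v => [true :: v, false :: v])
    (by fun_prop) (by fun_prop) (by fun_prop)
    (S := fun x => (2 * x.1.2.1) * (x.1.2.1 * 2 + 1) + 1)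
    (.add (.mul (.mul (.const _) polyBdd_b) (.add (.mul polyBdd_b (.const _)) (.const _)))
      (.const _)) ?_
  intro x l hl
  obtain ⟨i, hi, rfl⟩ := exists_eq_range_of_prefix hl
  change esize (boolVecs i) ≤ _
  refine (esize_list_le (s := x.1.2.1 * 2 + 1) fun v hv => ?_).trans ?_
  · have h1 := esize_bools_le v
    rw [mem_boolVecs.1 hv] at h1
    have := x.groupSize_le
    omega
  · rw [length_boolVecs]
    gcongr
    exact (Nat.pow_le_pow_right (by norm_num) hi).trans x.two_pow_groupSize_le

theorem polyTime_rows : PolyTime fun x : Input => x.rows := by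
  have := polyTime_groupSize
  refine .foldl (γ := Input) (α := ℕ) (step := fun _ M _ => detectStep M)
    (by fun_prop) (by fun_prop) (by fun_prop)
    (S := fun x => (4 * x.1.2.1) * (x.1.2.1 * (4 * x.1.2.1) * 2 + 1) + 1)
    (.add (.mul (.mul (.const _) polyBdd_b) (.add (.mul (.mul polyBdd_b
      (.mul (.const _) polyBdd_b)) (.const _)) (.const _))) (.const _)) ?_
  intro x l hl
  obtain ⟨i, hi, rfl⟩ := exists_eq_range_of_prefix hl
  change esize (detectRows i) ≤ _
  have h4 : 4 ^ i ≤ 4 * x.1.2.1 :=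
    (Nat.pow_le_pow_right (by norm_num) hi).trans x.four_pow_groupSize_le
  refine (esize_list_le (s := x.1.2.1 * (4 * x.1.2.1) * 2 + 1) fun v hv => ?_).trans ?_
  · have h1 := esize_bools_le v
    have h2 := length_of_mem_detectRows hv
    have h3 : i * 4 ^ i ≤ x.1.2.1 * (4 * x.1.2.1) :=
      Nat.mul_le_mul (hi.trans x.groupSize_le) h4
    omega
  · rw [length_detectRows]
    gcongr

variable {γ : Type} [Enc γ] {f : γ → Input}

@[fun_prop] theorem polyTime_numVars' (hf : PolyTime f) : PolyTime fun y => (f y).numVars := by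
  unfold numVars; fun_prop

@[fun_prop] theorem polyTime_clauses' (hf : PolyTime f) : PolyTime fun y => (f y).clauses := by
  unfold clauses; fun_prop

@[fun_prop] theorem polyTime_groupSize' (hf : PolyTime f) :
    PolyTime fun y => (f y).groupSize := .comp polyTime_groupSize hf

@[fun_prop] theorem polyTime_vecs' (hf : PolyTime f) :
    PolyTime fun y => (f y).vecs := .comp polyTime_vecs hf

@[fun_prop] theorem polyTime_rows' (hf : PolyTime f) :
    PolyTime fun y => (f y).rows := .comp polyTime_rows hf

@[fun_prop] theorem polyTime_width (hf : PolyTime f) : PolyTime fun y => (f y).width := by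
  unfold width; fun_prop

@[fun_prop] theorem polyTime_numVarGroups (hf : PolyTime f) :
    PolyTime fun y => (f y).numVarGroups := by
  unfold numVarGroups; fun_prop

@[fun_prop] theorem polyTime_varConf {v w : γ → ℕ} (hf : PolyTime f) (hv : PolyTime v)
    (hw : PolyTime w) : PolyTime fun y => (f y).varConf (v y) (w y) := by
  unfold varConf; fun_prop

@[fun_prop] theorem polyTime_varBins (hf : PolyTime f) : PolyTime fun y => (f y).varBins := by
  unfold varBins
  exact .greedy (conf := fun y => (f y).varConf) (by fun_prop) (by fun_prop) (by fun_prop)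
    (by fun_prop)

@[fun_prop] theorem polyTime_groupOf {v : γ → ℕ} (hf : PolyTime f) (hv : PolyTime v) :
    PolyTime fun y => (f y).groupOf (v y) := by
  unfold groupOf; fun_prop

@[fun_prop] theorem polyTime_numClauseGroups (hf : PolyTime f) :
    PolyTime fun y => (f y).numClauseGroups := by
  unfold numClauseGroups; fun_prop

@[fun_prop] theorem polyTime_clauseConf {v w : γ → NatClause} (hf : PolyTime f)
    (hv : PolyTime v) (hw : PolyTime w) : PolyTime fun y => (f y).clauseConf (v y) (w y) := by
  unfold clauseConf; fun_prop

@[fun_prop] theorem polyTime_clauseBins (hf : PolyTime f) :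
    PolyTime fun y => (f y).clauseBins := by
  unfold clauseBins
  exact .greedy (conf := fun y => (f y).clauseConf) (by fun_prop) (by fun_prop) (by fun_prop)
    (by fun_prop)

@[fun_prop] theorem polyTime_group {j : γ → ℕ} (hf : PolyTime f) (hj : PolyTime j) :
    PolyTime fun y => (f y).group (j y) := by
  unfold group; fun_prop

@[fun_prop] theorem polyTime_touch {i : γ → ℕ} (hf : PolyTime f) (hi : PolyTime i) :
    PolyTime fun y => (f y).touch (i y) := by
  unfold touch; fun_prop

@[fun_prop] theorem polyTime_numSlots (hf : PolyTime f) :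
    PolyTime fun y => (f y).numSlots := by
  unfold numSlots; fun_prop

@[fun_prop] theorem polyTime_slotConf {v w : γ → ℕ} (hf : PolyTime f) (hv : PolyTime v)
    (hw : PolyTime w) : PolyTime fun y => (f y).slotConf (v y) (w y) := by
  unfold slotConf; fun_prop

@[fun_prop] theorem polyTime_slotBins (hf : PolyTime f) :
    PolyTime fun y => (f y).slotBins := by
  unfold slotBins
  exact .greedy (conf := fun y => (f y).slotConf) (by fun_prop) (by fun_prop) (by fun_prop)
    (by fun_prop)

@[fun_prop] theorem polyTime_slot {i : γ → ℕ} (hf : PolyTime f) (hi : PolyTime i) :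
    PolyTime fun y => (f y).slot (i y) := by
  unfold slot; fun_prop

@[fun_prop] theorem polyTime_litColors {l : γ → ℕ × Bool} (hf : PolyTime f) (hl : PolyTime l) :
    PolyTime fun y => (f y).litColors (l y) := by
  unfold litColors; fun_prop

@[fun_prop] theorem polyTime_satColors {l : γ → ℕ × Bool} (hf : PolyTime f) (hl : PolyTime l) :
    PolyTime fun y => (f y).satColors (l y) := by
  unfold satColors; fun_prop

@[fun_prop] theorem polyTime_palette (hf : PolyTime f) : PolyTime fun y => (f y).palette := by
  unfold palette; fun_prop

@[fun_prop] theorem polyTime_varVertex {i : γ → ℕ} (hf : PolyTime f) (hi : PolyTime i) :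
    PolyTime fun y => (f y).varVertex (i y) := by
  unfold varVertex; fun_prop

@[fun_prop] theorem polyTime_selVertex {j : γ → ℕ} (hf : PolyTime f) (hj : PolyTime j) :
    PolyTime fun y => (f y).selVertex (j y) := by
  unfold selVertex; fun_prop

@[fun_prop] theorem polyTime_resVertex {j : γ → ℕ} (hf : PolyTime f) (hj : PolyTime j) :
    PolyTime fun y => (f y).resVertex (j y) := by
  unfold resVertex; fun_prop

@[fun_prop] theorem polyTime_rowVertex {j : γ → ℕ} {r : γ → List Bool} {s : γ → Bool}
    (hf : PolyTime f) (hj : PolyTime j) (hr : PolyTime r) (hs : PolyTime s) :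
    PolyTime fun y => (f y).rowVertex (j y) (r y) (s y) := by
  unfold rowVertex; fun_prop

@[fun_prop] theorem polyTime_vertices (hf : PolyTime f) : PolyTime fun y => (f y).vertices := by
  unfold vertices allVertices; fun_prop

theorem polyTime_output : PolyTime fun x : Input => x.output := by
  unfold output; fun_prop

end Input

/-! ### Detecting matrices -/

/-- The sum of the entries of `f` at the positions where `r` has the entry `true`. -/
def rowSum : List Bool → List ℤ → ℤ
  | s :: r, a :: f => (if s then a else 0) + rowSum r f
  | _, _ => 0

theorem rowSum_append {r : List Bool} {f : List ℤ} (h : r.length = f.length) (r' : List Bool)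
    (f' : List ℤ) : rowSum (r ++ r') (f ++ f') = rowSum r f + rowSum r' f' := by
  induction r generalizing f with
  | nil =>
    rw [List.length_nil, eq_comm, List.length_eq_zero_iff] at h
    simp [h, rowSum]
  | cons s r ih =>
    cases f with
    | nil => simp at h
    | cons a f => simp [rowSum, ih (Nat.succ.inj h), add_assoc]

theorem rowSum_false (r : List Bool) (f : List ℤ) : rowSum (r.map fun _ => false) f = 0 := by
  induction r generalizing f with
  | nil => rfl
  | cons s r ih =>
    cases f with
    | nil => rfl
    | cons a f => rw [List.map_cons, rowSum, ih]; rfl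

theorem rowSum_append_replicate_zero (r : List Bool) (f : List ℤ) (n : ℕ) :
    rowSum r (f ++ List.replicate n 0) = rowSum r f := by
  induction r generalizing f n with
  | nil => cases f <;> cases n <;> rfl
  | cons s r ih =>
    cases f with
    | nil =>
      cases n with
      | zero => rfl
      | succ n =>
        have := ih [] n
        rw [List.nil_append] at this ⊢
        rw [List.replicate_succ, rowSum, this]
        cases r <;> simp [rowSum]
    | cons a f => simp [rowSum, ih]

theorem rowSum_map_map {α : Type} (l : List α) (g : α → Bool) (h : α → ℤ) :
    rowSum (l.map g) (l.map h) = (l.map fun a => if g a then h a else 0).sum := by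
  induction l with
  | nil => rfl
  | cons a l ih => simp [rowSum, ih]

theorem rowSum_unitRow (f : List ℤ) (p : ℕ) (hp : p < f.length) :
    rowSum ((List.range f.length).map fun q => p == q) f = f[p] := by
  have hf : f = (List.range f.length).map fun q => f.getD q 0 := by
    refine List.ext_getElem (by simp) fun i h1 h2 => ?_
    simp [h1]
  conv_lhs => rw [hf]
  rw [List.length_map, List.length_range, rowSum_map_map, ← List.sum_toFinset _ List.nodup_range]
  simp [hp]

theorem exists_append_of_length {α : Type} {l : List α} {m n : ℕ} (h : l.length = m + n) :
    ∃ l₁ l₂, l = l₁ ++ l₂ ∧ l₁.length = m ∧ l₂.length = n :=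
  ⟨l.take m, l.drop m, (List.take_append_drop m l).symm, by simp [h], by simp [h]⟩

/-- The inductive step. For a row `r` of the old matrix, let `tᵢ` be its sum on the block `i`. The
four new rows give `∑ (i ≠ d), tᵢ = 0` for `d = 1, 2, 3`, and the same with the new entry `z`
added for `d = 0`. In total `3 (t₀ + t₁ + t₂ + t₃) + z = 0`, so `z` is a multiple of three in
`[-1, 2]`. -/
theorem detectStep_detects {M : List (List Bool)} {w : ℕ} (hw : ∀ r ∈ M, r.length = w)
    (hM : ∀ f : List ℤ, f.length = w → (∀ a ∈ f, -1 ≤ a ∧ a ≤ 2) →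
      (∀ r ∈ M, rowSum r f = 0) → ∀ a ∈ f, a = 0)
    {f : List ℤ} (hf : f.length = w + (w + (w + (w + M.length))))
    (hb : ∀ a ∈ f, -1 ≤ a ∧ a ≤ 2) (h0 : ∀ r ∈ detectStep M, rowSum r f = 0) :
    ∀ a ∈ f, a = 0 := by
  obtain ⟨f₀, f, rfl, l₀, hf⟩ := exists_append_of_length hf
  obtain ⟨f₁, f, rfl, l₁, hf⟩ := exists_append_of_length hf
  obtain ⟨f₂, f, rfl, l₂, hf⟩ := exists_append_of_length hf
  obtain ⟨f₃, z, rfl, l₃, hz⟩ := exists_append_of_length hf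
  have key : ∀ p (hp : p < M.length), z[p] = 0 ∧ rowSum M[p] f₀ = 0 ∧ rowSum M[p] f₁ = 0 ∧
      rowSum M[p] f₂ = 0 ∧ rowSum M[p] f₃ = 0 := by
    intro p hp
    have hr := hw _ (List.getElem_mem hp)
    have hmem : (M[p], (List.range M.length).map fun q => p == q) ∈ M.zip (unitRows M.length) := by
      have hlen : p < (M.zip (unitRows M.length)).length := by
        simp [unitRows, hp]
      have := List.getElem_mem hlen
      rw [List.getElem_zip] at this
      simpa [unitRows] using this
    have row : ∀ d < 4, rowSum (((List.range 4).flatMap fun i =>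
        bif i == d then M[p].map (fun _ => false) else M[p]) ++
        bif d == 0 then (List.range M.length).map (fun q => p == q)
          else ((List.range M.length).map fun q => p == q).map fun _ => false)
        (f₀ ++ (f₁ ++ (f₂ ++ (f₃ ++ z)))) = 0 := fun d hd =>
      h0 _ (List.mem_flatMap.2 ⟨d, List.mem_range.2 hd, List.mem_map.2 ⟨_, hmem, rfl⟩⟩)
    have hu : rowSum ((List.range M.length).map fun q => p == q) z = z[p] := by
      have := rowSum_unitRow z p (by omega)
      simpa only [hz] using this
    have hr4 : List.range 4 = [0, 1, 2, 3] := rfl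
    have ht : (M[p].map fun _ => false).length = w := by rw [List.length_map, hr]
    have e0 := row 0 (by norm_num)
    have e1 := row 1 (by norm_num)
    have e2 := row 2 (by norm_num)
    have e3 := row 3 (by norm_num)
    simp only [hr4, List.flatMap_cons, List.flatMap_nil, List.append_nil, List.append_assoc,
      beq_self_eq_true, cond_true, Nat.reduceBEq, cond_false] at e0 e1 e2 e3
    rw [rowSum_append (ht.trans l₀.symm), rowSum_append (hr.trans l₁.symm),
      rowSum_append (hr.trans l₂.symm), rowSum_append (hr.trans l₃.symm), rowSum_false, hu] at e0
    rw [rowSum_append (hr.trans l₀.symm), rowSum_append (ht.trans l₁.symm),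
      rowSum_append (hr.trans l₂.symm), rowSum_append (hr.trans l₃.symm), rowSum_false,
      rowSum_false] at e1
    rw [rowSum_append (hr.trans l₀.symm), rowSum_append (hr.trans l₁.symm),
      rowSum_append (ht.trans l₂.symm), rowSum_append (hr.trans l₃.symm), rowSum_false,
      rowSum_false] at e2
    rw [rowSum_append (hr.trans l₀.symm), rowSum_append (hr.trans l₁.symm),
      rowSum_append (hr.trans l₂.symm), rowSum_append (ht.trans l₃.symm), rowSum_false,
      rowSum_false] at e3
    have := hb z[p] (by simp)
    omega
  have old : ∀ g : List ℤ, g.length = w → (∀ a ∈ g, -1 ≤ a ∧ a ≤ 2) →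
      (∀ p (hp : p < M.length), rowSum M[p] g = 0) → ∀ a ∈ g, a = 0 := fun g hg hgb hg0 =>
    hM g hg hgb fun r hr => by
      obtain ⟨p, hp, rfl⟩ := List.getElem_of_mem hr
      exact hg0 p hp
  intro a ha
  simp only [List.mem_append] at ha hb
  rcases ha with ha | ha | ha | ha | ha
  · exact old f₀ l₀ (fun a ha => hb a (by tauto)) (fun p hp => (key p hp).2.1) a ha
  · exact old f₁ l₁ (fun a ha => hb a (by tauto)) (fun p hp => (key p hp).2.2.1) a ha
  · exact old f₂ l₂ (fun a ha => hb a (by tauto)) (fun p hp => (key p hp).2.2.2.1) a ha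
  · exact old f₃ l₃ (fun a ha => hb a (by tauto)) (fun p hp => (key p hp).2.2.2.2) a ha
  · obtain ⟨p, hp, rfl⟩ := List.getElem_of_mem ha
    exact (key p (by omega)).1

/-- A vector with entries in `[-1, 2]` vanishes if all rows of the matrix do on it. -/
theorem detectRows_detects (k : ℕ) (f : List ℤ) (hf : 4 * f.length = k * 4 ^ k)
    (hb : ∀ a ∈ f, -1 ≤ a ∧ a ≤ 2) (h0 : ∀ r ∈ detectRows k, rowSum r f = 0) :
    ∀ a ∈ f, a = 0 := by
  induction k generalizing f with
  | zero =>
    rw [zero_mul, mul_eq_zero, List.length_eq_zero_iff] at hf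
    simp [hf.resolve_left (by norm_num)]
  | succ k ih =>
    obtain ⟨r, hr⟩ : ∃ r, r ∈ detectRows k := List.exists_mem_of_length_pos (by
      rw [length_detectRows]; positivity)
    have hlen := length_of_mem_detectRows hr
    refine detectStep_detects (w := r.length) (fun r' hr' => ?_)
      (fun g hg => ih g (by rw [hg, hlen])) ?_ hb (by rwa [← detectRows_succ])
    · have := length_of_mem_detectRows hr'
      omega
    · rw [pow_succ] at hf
      rw [length_detectRows]
      have : 4 * f.length = 4 * (k * 4 ^ k + 4 ^ k) := by rw [hf]; ring
      omega

theorem rowSum_eq_sum_select {α : Type} (l : List α) (r : List Bool) (g : α → ℤ) :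
    rowSum r (l.map g) = ((select l r true).map g).sum := by
  induction l generalizing r with
  | nil => cases r <;> rfl
  | cons a l ih =>
    cases r with
    | nil => rfl
    | cons s r => cases s <;> simp [rowSum, select, ih]

theorem select_sublist {α : Type} (l : List α) (r : List Bool) (s : Bool) :
    (select l r s).Sublist l := by
  refine (List.filter_sublist.map _).trans ?_
  induction l generalizing r with
  | nil => simp
  | cons a l ih =>
    cases r with
    | nil => simp
    | cons t r => simpa using ih r

theorem sum_select_add {α : Type} (l : List α) (r : List Bool) (h : l.length ≤ r.length)
    (g : α → ℕ) :
    ((select l r true).map g).sum + ((select l r false).map g).sum = (l.map g).sum := by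
  induction l generalizing r with
  | nil => rfl
  | cons a l ih =>
    cases r with
    | nil => simp at h
    | cons t r =>
      have := ih r (by simpa using h)
      cases t <;> simp [select] at this ⊢ <;> omega

/-- The form in which detection is used: numbers in `[0, 3]` are all equal to one if, for every
row and for its complement, their sum is at least the number of summands, and the total sum is
the number of all summands. -/
theorem eq_one_of_le_sum_select {α : Type} {k : ℕ} {l : List α} {e : α → ℕ}
    (hl : 4 * l.length ≤ k * 4 ^ k) (he : ∀ a ∈ l, e a ≤ 3) (htot : (l.map e).sum = l.length)
    (h : ∀ r ∈ detectRows k, ∀ s, (select l r s).length ≤ ((select l r s).map e).sum) :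
    ∀ a ∈ l, e a = 1 := by
  obtain ⟨r₀, hr₀⟩ : ∃ r, r ∈ detectRows k := List.exists_mem_of_length_pos (by
    rw [length_detectRows]; positivity)
  have hlen := length_of_mem_detectRows hr₀
  -- The group of clauses may be smaller than the number of columns; it is filled up with zeros.
  have hzero := detectRows_detects k
    (l.map (fun a => (e a : ℤ) - 1) ++ List.replicate (r₀.length - l.length) 0)
    (by rw [List.length_append, List.length_map, List.length_replicate]; omega)
    (fun a ha => by
      rcases List.mem_append.1 ha with ha | ha
      · obtain ⟨c, hc, rfl⟩ := List.mem_map.1 ha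
        have := he c hc
        omega
      · rw [List.eq_of_mem_replicate ha]; omega)
    (fun r hr => by
      rw [rowSum_append_replicate_zero, rowSum_eq_sum_select]
      have hr' := length_of_mem_detectRows hr
      have h1 := h r hr true
      have h2 := h r hr false
      have h3 := sum_select_add l r (by omega) e
      have h4 := sum_select_add l r (by omega) fun _ => 1
      simp only [List.map_const', List.sum_replicate, smul_eq_mul, mul_one] at h4
      have h5 : ∀ m : List α,
          (m.map fun a => (e a : ℤ) - 1).sum = ((m.map e).sum : ℕ) - m.length := by
        intro m
        induction m with
        | nil => rfl
        | cons a m ih =>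
          simp only [List.map_cons, List.sum_cons, ih, List.length_cons]
          push_cast
          ring
      rw [h5]
      omega)
  intro a ha
  have := hzero ((e a : ℤ) - 1) (List.mem_append_left _ (List.mem_map.2 ⟨a, ha, rfl⟩))
  omega

/-! ### The greedy distribution into bins -/

theorem countP_any_le {α β : Type} (l : List α) (Y : List β) (p : β → α → Bool) {D : ℕ}
    (h : ∀ y ∈ Y, l.countP (p y) ≤ D) :
    (l.countP fun a => Y.any fun y => p y a) ≤ Y.length * D := by
  induction Y with
  | nil => simp
  | cons y Y ih =>
    have h1 := ih fun z hz => h z (List.mem_cons_of_mem _ hz)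
    have h2 := h y List.mem_cons_self
    have h3 : ∀ l : List α, (l.countP fun a => (y :: Y).any fun y => p y a) ≤
        l.countP (p y) + l.countP fun a => Y.any fun y => p y a := by
      intro l
      induction l with
      | nil => simp
      | cons a l ih =>
        simp only [List.any_cons, List.countP_cons] at ih ⊢
        cases p y a <;> cases (Y.any fun y => p y a) <;> simp <;> omega
    have h4 := h3 l
    rw [List.length_cons, Nat.succ_mul]
    omega

section greedy

variable {α : Type}

theorem mem_members {acc : List (α × ℕ)} {a : α} {j : ℕ} :
    a ∈ members acc j ↔ (a, j) ∈ acc := by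
  simp [members]

theorem members_append (acc : List (α × ℕ)) (a : α) (i j : ℕ) :
    members (acc ++ [(a, i)]) j = members acc j ++ if i = j then [a] else [] := by
  by_cases h : i = j <;> simp [members, h]

theorem binOf_mem [BEq α] [LawfulBEq α] [Inhabited α] {acc : List (α × ℕ)} {a : α}
    (h : a ∈ acc.map Prod.fst) : (a, binOf acc a) ∈ acc := by
  unfold binOf
  obtain ⟨p, hp, rfl⟩ := List.mem_map.1 h
  have hp' : p ∈ acc.filter fun q => q.1 == p.1 := List.mem_filter.2 ⟨hp, beq_self_eq_true _⟩
  cases hF : acc.filter fun q => q.1 == p.1 with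
  | nil => rw [hF] at hp'; simp at hp'
  | cons q F =>
    have hq : q ∈ acc.filter fun q => q.1 == p.1 := by rw [hF]; exact List.mem_cons_self
    rw [List.mem_filter, beq_iff_eq] at hq
    rw [List.headD_cons, ← hq.2]
    exact hq.1

/-- There are enough bins: at most `acc.length / cap` bins are full, and at most `D` contain an
item in conflict with `a`. -/
theorem firstBin_spec {conf : α → α → Bool} {cap B D : ℕ} (hcap : 1 ≤ cap)
    {acc : List (α × ℕ)} {a : α} (hD : acc.countP (fun p => conf a p.1) ≤ D)
    (hB : acc.length / cap + D < B) :
    firstBin conf cap B acc a < B ∧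
      (members acc (firstBin conf cap B acc a)).length < cap ∧
      ∀ a' ∈ members acc (firstBin conf cap B acc a), conf a a' = false := by
  set F := (List.range B).filter fun j =>
    decide ((members acc j).length < cap) && (members acc j).all fun a' => !conf a a' with hF
  have hne : F ≠ [] := by
    intro hnil
    have hcover : Finset.range B ⊆
        (Finset.range B).filter (fun j => cap ≤ (members acc j).length) ∪
          ((acc.filter fun p => conf a p.1).map Prod.snd).toFinset := by
      intro j hj
      by_contra hcon
      simp only [Finset.mem_union, Finset.mem_filter, hj, true_and, not_or, not_le,
        List.mem_toFinset, List.mem_map, List.mem_filter, Prod.exists, exists_eq_right,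
        not_exists, not_and, Bool.not_eq_true] at hcon
      have : j ∈ F := by
        rw [hF, List.mem_filter]
        refine ⟨by simpa using hj, ?_⟩
        rw [Bool.and_eq_true, decide_eq_true_eq, List.all_eq_true]
        refine ⟨hcon.1, fun a' ha' => ?_⟩
        rw [hcon.2 a' (mem_members.1 ha')]; rfl
      rw [hnil] at this
      simp at this
    have h1 := Finset.card_le_card hcover
    have h2 := Finset.card_union_le
      ((Finset.range B).filter (fun j => cap ≤ (members acc j).length))
      ((acc.filter fun p => conf a p.1).map Prod.snd).toFinset
    have h3 := List.toFinset_card_le ((acc.filter fun p => conf a p.1).map Prod.snd)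
    rw [List.length_map, ← List.countP_eq_length_filter] at h3
    have hsum : ∀ acc : List (α × ℕ),
        ∑ j ∈ Finset.range B, (members acc j).length ≤ acc.length := by
      intro acc
      induction acc with
      | nil => simp [members]
      | cons p acc ih =>
        have hp : ∀ j, (members (p :: acc) j).length =
            (members acc j).length + if p.2 = j then 1 else 0 := by
          intro j
          by_cases h : p.2 = j <;> simp [members, h]
        simp only [hp, Finset.sum_add_distrib, List.length_cons]
        have : (∑ j ∈ Finset.range B, if p.2 = j then 1 else 0) ≤ 1 := by
          rw [Finset.sum_ite_eq]; split <;> omega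
        omega
    have h4 : ((Finset.range B).filter (fun j => cap ≤ (members acc j).length)).card * cap ≤
        acc.length := by
      refine le_trans ?_ (hsum acc)
      refine le_trans ?_ (Finset.sum_le_sum_of_subset (Finset.filter_subset
        (fun j => cap ≤ (members acc j).length) (Finset.range B)))
      rw [← smul_eq_mul]
      exact Finset.card_nsmul_le_sum _ _ _ fun j hj => (Finset.mem_filter.1 hj).2
    rw [← Nat.le_div_iff_mul_le hcap] at h4
    rw [Finset.card_range] at h1
    omega
  obtain ⟨j, F', hjF⟩ := List.exists_cons_of_ne_nil hne
  have hfirst : firstBin conf cap B acc a = j := by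
    change F.headD 0 = j
    rw [hjF]; rfl
  have hj : j ∈ F := by rw [hjF]; exact List.mem_cons_self
  rw [hF, List.mem_filter, Bool.and_eq_true, decide_eq_true_eq, List.all_eq_true] at hj
  rw [hfirst]
  refine ⟨by simpa using hj.1, hj.2.1, fun a' ha' => ?_⟩
  simpa using hj.2.2 a' ha'

theorem greedy_append (conf : α → α → Bool) (cap B : ℕ) (l : List α) (a : α) :
    greedy conf cap B (l ++ [a]) =
      greedy conf cap B l ++ [(a, firstBin conf cap B (greedy conf cap B l) a)] := by
  unfold greedy
  rw [List.foldl_append]; rfl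

theorem map_fst_greedy (conf : α → α → Bool) (cap B : ℕ) (items : List α) :
    (greedy conf cap B items).map Prod.fst = items := by
  induction items using List.reverseRecOn with
  | nil => rfl
  | append_singleton l a ih => rw [greedy_append, List.map_append, ih]; rfl

/-- If no item is in conflict with more than `D` items, then `⌊items.length / cap⌋ + D + 1` bins
suffice. -/
theorem greedy_spec {conf : α → α → Bool} {cap B D : ℕ} (hcap : 1 ≤ cap) {items : List α}
    (hD : ∀ a ∈ items, items.countP (conf a) ≤ D) (hB : items.length / cap + D < B) :
    (∀ p ∈ greedy conf cap B items, p.2 < B) ∧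
    ∀ j, (members (greedy conf cap B items) j).length ≤ cap ∧
      (members (greedy conf cap B items) j).Pairwise fun a a' => conf a' a = false := by
  induction items using List.reverseRecOn with
  | nil => simp [greedy, members]
  | append_singleton l a ih =>
    obtain ⟨ih1, ih2⟩ := ih (fun b hb => by
        have := hD b (List.mem_append_left _ hb)
        rw [List.countP_append] at this
        omega)
      (lt_of_le_of_lt (by gcongr; simp) hB)
    have hlen : (greedy conf cap B l).length = l.length := by
      conv_rhs => rw [← map_fst_greedy conf cap B l, List.length_map]
    obtain ⟨s1, s2, s3⟩ := firstBin_spec (conf := conf) (cap := cap) (B := B) (D := D)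
      (acc := greedy conf cap B l) (a := a) hcap (by
        have := hD a (List.mem_append_right _ List.mem_cons_self)
        rw [List.countP_append] at this
        have h2 : (greedy conf cap B l).countP (fun p => conf a p.1) = l.countP (conf a) := by
          conv_rhs => rw [← map_fst_greedy conf cap B l, List.countP_map]
          rfl
        omega)
      (by rw [hlen]; exact lt_of_le_of_lt (by gcongr; simp) hB)
    rw [greedy_append]
    refine ⟨fun p hp => ?_, fun j => ?_⟩
    · rcases List.mem_append.1 hp with hp | hp
      · exact ih1 p hp
      · rw [List.mem_singleton.1 hp]; exact s1
    · rw [members_append]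
      split_ifs with h
      · rw [← h]
        refine ⟨by simpa using s2, ?_⟩
        rw [List.pairwise_append]
        refine ⟨(ih2 _).2, List.pairwise_singleton _ _, fun b hb c hc => ?_⟩
        rw [List.mem_singleton.1 hc]
        exact s3 b hb
      · simpa using ih2 j

end greedy

theorem quot_eq {n k : ℕ} (hk : 1 ≤ k) : quot n k = n / k := by
  have h : (List.range n).filter (fun i => decide ((i + 1) * k ≤ n)) =
      (List.range n).filter fun i => decide (i < n / k) :=
    List.filter_congr fun i _ => by
      rw [decide_eq_decide, ← Nat.le_div_iff_mul_le hk, Nat.succ_le_iff]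
  rw [quot, h, ← List.countP_eq_length_filter]
  have hle : n / k ≤ n := Nat.div_le_self n k
  obtain ⟨m, hm⟩ := Nat.exists_eq_add_of_le hle
  rw [show List.range n = List.range (n / k) ++ (List.range m).map (fun x => n / k + x) by
    rw [← List.range_add, ← hm], List.countP_append]
  have h1 : (List.range (n / k)).countP (fun i => decide (i < n / k)) = n / k := by
    rw [List.countP_eq_length.2 fun i hi => by simpa using hi, List.length_range]
  have h2 : ((List.range m).map fun x => n / k + x).countP (fun i => decide (i < n / k)) = 0 := by
    rw [List.countP_eq_zero]
    intro i hi
    obtain ⟨j, -, rfl⟩ := List.mem_map.1 hi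
    simp
  rw [h1, h2, add_zero]

theorem countP_le_of_subset {α : Type} {l l' : List α} (hl : l.Nodup) {p : α → Bool}
    (h : ∀ a ∈ l, p a = true → a ∈ l') : l.countP p ≤ l'.length := by
  rw [List.countP_eq_length_filter]
  exact ((hl.filter _).subperm fun a ha => h a (List.mem_filter.1 ha).1
    (List.mem_filter.1 ha).2).length_le

theorem length_flatten_le {α : Type} {L : List (List α)} {D : ℕ} (h : ∀ l ∈ L, l.length ≤ D) :
    L.flatten.length ≤ L.length * D := by
  rw [List.length_flatten]
  refine (List.sum_le_card_nsmul _ D fun x hx => ?_).trans (by simp)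
  obtain ⟨l, hl, rfl⟩ := List.mem_map.1 hx
  exact h l hl

namespace Input

variable (x : Input)

/-! ### Groups of variables -/

theorem length_clause {c : NatClause} (hc : c ∈ x.clauses) : c.length = 3 := (x.2.2.2.1 c hc).1

theorem nodup_clause {c : NatClause} (hc : c ∈ x.clauses) : (c.map Prod.fst).Nodup :=
  (x.2.2.2.1 c hc).2.1

theorem lt_of_mem_clause {c : NatClause} (hc : c ∈ x.clauses) {l : ℕ × Bool} (hl : l ∈ c) :
    l.1 < x.numVars := (x.2.2.2.1 c hc).2.2 l hl

theorem countP_clauses_le {v : ℕ} (hv : v < x.numVars) :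
    x.clauses.countP (fun c => (c.map Prod.fst).contains v) ≤ 4 := x.2.2.2.2 v hv

theorem one_le_groupSize : 1 ≤ x.groupSize := x.groupSize_spec.1

theorem varConf_iff {v w : ℕ} : x.varConf v w = true ↔
    ∃ c ∈ x.clauses, v ∈ c.map Prod.fst ∧ w ∈ c.map Prod.fst := by
  simp only [varConf, List.any_eq_true, Bool.and_eq_true, List.contains_iff_mem]

theorem varBins_spec :
    (∀ p ∈ x.varBins, p.2 < x.numVarGroups) ∧
    ∀ j, (members x.varBins j).length ≤ x.groupSize ∧
      (members x.varBins j).Pairwise fun a a' => x.varConf a' a = false := by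
  refine greedy_spec (D := 12) x.one_le_groupSize (fun v hv => ?_) ?_
  · rw [List.mem_range] at hv
    refine (countP_le_of_subset (l' := ((x.clauses.filter fun c =>
      (c.map Prod.fst).contains v).map fun c => c.map Prod.fst).flatten)
      List.nodup_range fun w _ hw => ?_).trans ?_
    · obtain ⟨c, hc, h1, h2⟩ := x.varConf_iff.1 hw
      exact List.mem_flatten.2 ⟨_, List.mem_map.2 ⟨c, List.mem_filter.2
        ⟨hc, List.contains_iff_mem.2 h1⟩, rfl⟩, h2⟩
    · refine (length_flatten_le (D := 3) fun l hl => ?_).trans ?_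
      · obtain ⟨c, hc, rfl⟩ := List.mem_map.1 hl
        rw [List.length_map, x.length_clause (List.mem_filter.1 hc).1]
      · rw [List.length_map, ← List.countP_eq_length_filter]
        have := x.countP_clauses_le hv
        omega
  · rw [List.length_range, numVarGroups, quot_eq x.one_le_groupSize]
    omega

theorem map_fst_varBins : x.varBins.map Prod.fst = List.range x.numVars := map_fst_greedy ..

theorem mem_groupOf {v : ℕ} (hv : v < x.numVars) : (v, x.groupOf v) ∈ x.varBins :=
  binOf_mem (by rw [map_fst_varBins]; simpa using hv)

theorem groupOf_lt {v : ℕ} (hv : v < x.numVars) : x.groupOf v < x.numVarGroups :=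
  x.varBins_spec.1 (v, x.groupOf v) (x.mem_groupOf hv)

theorem mem_members_groupOf {v : ℕ} (hv : v < x.numVars) :
    v ∈ members x.varBins (x.groupOf v) := mem_members.2 (x.mem_groupOf hv)

theorem lt_of_mem_members {v i : ℕ} (h : v ∈ members x.varBins i) : v < x.numVars := by
  have : v ∈ x.varBins.map Prod.fst := List.mem_map.2 ⟨_, mem_members.1 h, rfl⟩
  rwa [map_fst_varBins, List.mem_range] at this

theorem nodup_members (i : ℕ) : (members x.varBins i).Nodup := by
  have h : x.varBins.map Prod.fst |>.Nodup := by
    rw [map_fst_varBins]; exact List.nodup_range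
  exact h.sublist (List.filter_sublist.map _)

theorem length_members_le (i : ℕ) : (members x.varBins i).length ≤ x.groupSize :=
  (x.varBins_spec.2 i).1

/-- The variables of a clause belong to different groups. -/
theorem groupOf_injOn_clause {c : NatClause} (hc : c ∈ x.clauses) :
    (c.map fun l => x.groupOf l.1).Nodup := by
  have h : ((c.map Prod.fst).map x.groupOf).Nodup := by
    refine (x.nodup_clause hc).map_on fun v hv w hw hvw => ?_
    by_contra hne
    have hlt : ∀ u ∈ c.map Prod.fst, u < x.numVars := fun u hu => by
      obtain ⟨l, hl, rfl⟩ := List.mem_map.1 hu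
      exact x.lt_of_mem_clause hc hl
    have h1 := x.mem_members_groupOf (hlt v hv)
    have h2 := x.mem_members_groupOf (hlt w hw)
    rw [← hvw] at h2
    have hsymm : Std.Symm fun a a' => x.varConf a' a = false := ⟨fun a a' h => by
      rw [← Bool.not_eq_true, varConf_iff] at h ⊢
      exact fun ⟨c, hc, h1, h2⟩ => h ⟨c, hc, h2, h1⟩⟩
    have := (x.varBins_spec.2 (x.groupOf v)).2.forall h2 h1 (Ne.symm hne)
    rw [← Bool.not_eq_true, varConf_iff] at this
    exact this ⟨c, hc, hv, hw⟩
  rwa [List.map_map] at h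

/-! ### Groups of clauses -/

theorem rows_ne_nil : ∃ r, r ∈ x.rows := List.exists_mem_of_length_pos (by
  rw [rows, length_detectRows]; positivity)

theorem width_spec : 4 * x.width = x.groupSize * 4 ^ x.groupSize := by
  obtain ⟨r, hr⟩ := x.rows_ne_nil
  refine length_of_mem_detectRows ?_
  change (x.rows.headD []) ∈ x.rows
  cases h : x.rows with
  | nil => simp [h] at hr
  | cons a l => simp

theorem one_le_width : 1 ≤ x.width := by
  have h1 := x.width_spec
  have h2 : 1 ≤ x.groupSize * 4 ^ x.groupSize := Nat.mul_pos x.one_le_groupSize (by positivity)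
  omega

theorem clauseConf_iff {c c' : NatClause} : x.clauseConf c c' = true ↔
    ∃ l ∈ c, ∃ l' ∈ c', x.groupOf l.1 = x.groupOf l'.1 := by
  simp only [clauseConf, List.any_eq_true, beq_iff_eq]

/-- At most four clauses contain a given variable, hence at most `4 k` contain a variable from a
given set of `k` variables. -/
theorem countP_clauses_of_vars {Y : List ℕ} (hY : ∀ v ∈ Y, v < x.numVars) {p : NatClause → Bool}
    (hp : ∀ c ∈ x.clauses, p c = true → ∃ v ∈ Y, v ∈ c.map Prod.fst) :
    x.clauses.countP p ≤ Y.length * 4 := by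
  refine le_trans (List.countP_mono_left fun c hc h => ?_)
    (countP_any_le x.clauses Y (fun v c => (c.map Prod.fst).contains v)
      fun v hv => x.countP_clauses_le (hY v hv))
  obtain ⟨v, hv, h⟩ := hp c hc h
  exact List.any_eq_true.2 ⟨v, hv, List.contains_iff_mem.2 h⟩

theorem clauseBins_spec :
    (∀ p ∈ x.clauseBins, p.2 < x.numClauseGroups) ∧
    ∀ j, (x.group j).length ≤ x.width ∧
      (x.group j).Pairwise fun a a' => x.clauseConf a' a = false := by
  refine greedy_spec (D := 12 * x.groupSize) x.one_le_width (fun c hc => ?_) ?_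
  · refine (x.countP_clauses_of_vars
      (Y := (c.map fun l => members x.varBins (x.groupOf l.1)).flatten)
      (fun v hv => ?_) (fun c' hc' h => ?_)).trans ?_
    · obtain ⟨_, h, hv⟩ := List.mem_flatten.1 hv
      obtain ⟨l, -, rfl⟩ := List.mem_map.1 h
      exact x.lt_of_mem_members hv
    · obtain ⟨l, hl, l', hl', h⟩ := x.clauseConf_iff.1 h
      refine ⟨l'.1, List.mem_flatten.2 ⟨_, List.mem_map.2 ⟨l, hl, rfl⟩, ?_⟩,
        List.mem_map.2 ⟨l', hl', rfl⟩⟩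
      rw [h]
      exact x.mem_members_groupOf (x.lt_of_mem_clause hc' hl')
    · have h := length_flatten_le (L := c.map fun l => members x.varBins (x.groupOf l.1))
        (D := x.groupSize) fun m hm => by
          obtain ⟨l, -, rfl⟩ := List.mem_map.1 hm
          exact x.length_members_le _
      rw [List.length_map, x.length_clause hc] at h
      omega
  · rw [numClauseGroups, quot_eq x.one_le_width]
    omega

theorem map_fst_clauseBins : x.clauseBins.map Prod.fst = x.clauses := map_fst_greedy ..

theorem mem_clauses_of_mem_group {j : ℕ} {c : NatClause} (h : c ∈ x.group j) :
    c ∈ x.clauses := by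
  rw [← map_fst_clauseBins]
  exact List.mem_map.2 ⟨_, mem_members.1 h, rfl⟩

theorem exists_mem_group {c : NatClause} (hc : c ∈ x.clauses) :
    ∃ j < x.numClauseGroups, c ∈ x.group j := by
  rw [← map_fst_clauseBins] at hc
  obtain ⟨p, hp, rfl⟩ := List.mem_map.1 hc
  exact ⟨p.2, x.clauseBins_spec.1 p hp, mem_members.2 hp⟩

theorem length_group_le (j : ℕ) : (x.group j).length ≤ x.width := (x.clauseBins_spec.2 j).1

theorem lt_of_mem_group {j : ℕ} {l : ℕ × Bool} (hl : l ∈ (x.group j).flatten) :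
    l.1 < x.numVars := by
  obtain ⟨c, hc, hl⟩ := List.mem_flatten.1 hl
  exact x.lt_of_mem_clause (x.mem_clauses_of_mem_group hc) hl

/-- The literals in a group of clauses have variables from different groups. -/
theorem groupOf_injOn_group (j : ℕ) :
    ((x.group j).flatten.map fun l => x.groupOf l.1).Nodup := by
  rw [List.map_flatten, List.nodup_flatten]
  constructor
  · intro m hm
    obtain ⟨c, hc, rfl⟩ := List.mem_map.1 hm
    exact x.groupOf_injOn_clause (x.mem_clauses_of_mem_group hc)
  · rw [List.pairwise_map]
    refine (x.clauseBins_spec.2 j).2.imp fun {c c'} h => ?_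
    rw [List.disjoint_left]
    intro i hi hi'
    obtain ⟨l, hl, rfl⟩ := List.mem_map.1 hi
    obtain ⟨l', hl', h'⟩ := List.mem_map.1 hi'
    rw [← Bool.not_eq_true, clauseConf_iff] at h
    exact h ⟨l', hl', l, hl, h'⟩

theorem length_flatten_group (j : ℕ) :
    (x.group j).flatten.length = 3 * (x.group j).length := by
  rw [List.length_flatten, List.map_congr_left (g := fun _ => 3) fun c hc =>
    x.length_clause (x.mem_clauses_of_mem_group hc)]
  simp [mul_comm]

/-! ### Slots -/

theorem mem_touch {i j : ℕ} : j ∈ x.touch i ↔ j < x.numClauseGroups ∧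
    ∃ l ∈ (x.group j).flatten, x.groupOf l.1 = i := by
  rw [touch, List.mem_filter, List.mem_range, List.contains_iff_mem, List.mem_map]

theorem length_touch_le (i : ℕ) : (x.touch i).length ≤ 4 * x.groupSize := by
  have h1 : (x.touch i).length ≤ ((x.clauseBins.filter fun p =>
      (p.1.map fun l => x.groupOf l.1).contains i).map Prod.snd).length := by
    refine (List.Nodup.subperm (List.nodup_range.filter _) fun j hj => ?_).length_le
    obtain ⟨-, l, hl, hi⟩ := x.mem_touch.1 hj
    obtain ⟨c, hc, hl⟩ := List.mem_flatten.1 hl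
    exact List.mem_map.2 ⟨(c, j), List.mem_filter.2 ⟨mem_members.1 hc,
      List.contains_iff_mem.2 (List.mem_map.2 ⟨l, hl, hi⟩)⟩, rfl⟩
  have h2 : (x.clauseBins.countP fun p => (p.1.map fun l => x.groupOf l.1).contains i) =
      x.clauses.countP fun c => (c.map fun l => x.groupOf l.1).contains i := by
    conv_rhs => rw [← map_fst_clauseBins, List.countP_map]
    rfl
  have h3 : (x.clauses.countP fun c => (c.map fun l => x.groupOf l.1).contains i) ≤
      (members x.varBins i).length * 4 := by
    refine x.countP_clauses_of_vars (fun v hv => x.lt_of_mem_members hv) fun c hc h => ?_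
    obtain ⟨l, hl, rfl⟩ := List.mem_map.1 (List.contains_iff_mem.1 h)
    exact ⟨l.1, x.mem_members_groupOf (x.lt_of_mem_clause hc hl), List.mem_map.2 ⟨l, hl, rfl⟩⟩
  have h4 := x.length_members_le i
  rw [List.length_map, ← List.countP_eq_length_filter] at h1
  omega

theorem slotConf_iff {i i' : ℕ} : x.slotConf i i' = true ↔ ∃ j ∈ x.touch i, j ∈ x.touch i' := by
  simp only [slotConf, List.any_eq_true, List.contains_iff_mem]

theorem slotBins_spec :
    (∀ p ∈ x.slotBins, p.2 < x.numSlots) ∧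
    ∀ j, (members x.slotBins j).length ≤ x.numVarGroups + 1 ∧
      (members x.slotBins j).Pairwise fun a a' => x.slotConf a' a = false := by
  refine greedy_spec (D := 12 * x.groupSize * x.width) (by omega) (fun i hi => ?_) ?_
  · refine (countP_le_of_subset (l' := ((x.touch i).map fun j =>
      (x.group j).flatten.map fun l => x.groupOf l.1).flatten)
      List.nodup_range fun i' _ hi' => ?_).trans ?_
    · obtain ⟨j, hj, hj'⟩ := x.slotConf_iff.1 hi'
      obtain ⟨-, l, hl, rfl⟩ := x.mem_touch.1 hj'
      exact List.mem_flatten.2 ⟨_, List.mem_map.2 ⟨j, hj, rfl⟩, List.mem_map.2 ⟨l, hl, rfl⟩⟩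
    · refine (length_flatten_le (D := 3 * x.width) fun m hm => ?_).trans ?_
      · obtain ⟨j, -, rfl⟩ := List.mem_map.1 hm
        rw [List.length_map, length_flatten_group]
        have := x.length_group_le j
        omega
      · rw [List.length_map]
        calc (x.touch i).length * (3 * x.width) ≤ 4 * x.groupSize * (3 * x.width) :=
              Nat.mul_le_mul_right _ (x.length_touch_le i)
          _ = _ := by ring
  · rw [List.length_range, Nat.div_eq_of_lt (by omega), numSlots]
    omega

theorem map_fst_slotBins : x.slotBins.map Prod.fst = List.range x.numVarGroups :=
  map_fst_greedy ..

theorem slot_mem {i : ℕ} (hi : i < x.numVarGroups) : (i, x.slot i) ∈ x.slotBins :=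
  binOf_mem (by rw [map_fst_slotBins]; simpa using hi)

theorem slot_lt {i : ℕ} (hi : i < x.numVarGroups) : x.slot i < x.numSlots :=
  x.slotBins_spec.1 (i, x.slot i) (x.slot_mem hi)

/-- Groups of variables that occur in the same group of clauses have different slots. -/
theorem slot_inj {i i' j : ℕ} (hi : i < x.numVarGroups) (hi' : i' < x.numVarGroups)
    (hj : j ∈ x.touch i) (hj' : j ∈ x.touch i') (h : x.slot i = x.slot i') : i = i' := by
  by_contra hne
  have h1 := mem_members.2 (x.slot_mem hi)
  have h2 := mem_members.2 (x.slot_mem hi')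
  rw [← h] at h2
  have hsymm : Std.Symm fun a a' => x.slotConf a' a = false := ⟨fun a a' h => by
    rw [← Bool.not_eq_true, slotConf_iff] at h ⊢
    exact fun ⟨j, h1, h2⟩ => h ⟨j, h2, h1⟩⟩
  have := (x.slotBins_spec.2 (x.slot i)).2.forall h1 h2 hne
  rw [← Bool.not_eq_true, slotConf_iff] at this
  exact this ⟨j, hj', hj⟩

/-! ### Size of the construction -/

theorem length_clauses_le : x.clauses.length ≤ 4 * x.numVars := by
  have h : x.clauses.countP (fun _ => true) ≤ (List.range x.numVars).length * 4 := by
    refine x.countP_clauses_of_vars (fun v hv => by simpa using hv) fun c hc _ => ?_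
    obtain ⟨l, hl⟩ := List.exists_mem_of_length_pos (l := c) (by rw [x.length_clause hc]; norm_num)
    exact ⟨l.1, by simpa using x.lt_of_mem_clause hc hl, List.mem_map.2 ⟨l, hl, rfl⟩⟩
  rw [List.countP_true, List.length_range] at h
  omega

theorem length_palette : x.palette.length = x.numSlots * 2 ^ x.groupSize := by
  rw [palette, List.length_flatMap]
  simp [vecs, length_boolVecs]

theorem length_vertices_le : x.vertices.length ≤
    x.numVarGroups + x.numClauseGroups * (2 + 2 * 4 ^ x.groupSize) := by
  refine (List.length_filter_le _ _).trans ?_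
  rw [allVertices, List.length_append, List.length_map, List.length_range, List.length_flatMap]
  simp only [List.length_cons, List.length_flatMap, List.length_nil, List.map_const',
    List.sum_replicate, smul_eq_mul, List.length_range]
  rw [rows, length_detectRows]
  apply le_of_eq
  ring

theorem width_le {q : ℕ} (h : x.groupSize ≤ q) (h4 : 4 ^ x.groupSize = 4 * q ^ 2) :
    x.width ≤ q ^ 3 := by
  have h1 := x.width_spec
  have h2 : x.groupSize * q ^ 2 ≤ q * q ^ 2 := Nat.mul_le_mul_right _ h
  rw [h4, mul_left_comm] at h1
  rw [pow_succ']
  omega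

theorem width_le_b : x.width ≤ x.1.2.1 := by
  obtain ⟨q, h1, h2, h3, -, h4⟩ := x.exists_scale
  have : q ^ 3 ≤ q ^ 4 := Nat.pow_le_pow_right h1 (by norm_num)
  have := x.width_le h3 h4
  omega

theorem length_palette_le : x.palette.length ≤ 26 * x.1.2.1 ^ 2 := by
  obtain ⟨q, h1, h2, h3, h4, h5⟩ := x.exists_scale
  have h6 := x.width_le h3 h5
  rw [length_palette, numSlots, h4]
  calc (12 * x.groupSize * x.width + 1) * (2 * q)
      ≤ (12 * q * q ^ 3 + q ^ 4) * (2 * q) := by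
        gcongr
        exact Nat.one_le_pow _ _ h1
    _ = 26 * q ^ 5 := by ring
    _ ≤ 26 * q ^ 8 := by gcongr; omega
    _ = 26 * (q ^ 4) ^ 2 := by ring
    _ ≤ 26 * x.1.2.1 ^ 2 := by gcongr

/-- The detecting matrix has fewer rows than columns by a factor of about `k / 4`, which
makes up for the factor `k` on the left; the groups needed on account of conflicts are few, as
`k ^ 2 * q ^ 2 ≤ q ^ 4 ≤ b ≤ n`. -/
theorem groupSize_mul_length_vertices_le :
    x.groupSize * x.vertices.length ≤ 300 * x.numVars := by
  obtain ⟨q, h1, h2, h3, -, h5⟩ := x.exists_scale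
  have hb : x.1.2.1 ≤ x.numVars := x.2.2.1
  set k := x.groupSize
  set n := x.numVars
  have hw : x.width = k * q ^ 2 := by
    have := x.width_spec
    rw [h5, mul_left_comm] at this
    change 4 * x.width = 4 * (k * q ^ 2) at this
    omega
  have hvar : k * x.numVarGroups ≤ n + 13 * k := by
    rw [numVarGroups, quot_eq x.one_le_groupSize, mul_add, mul_comm k 13]
    exact Nat.add_le_add_right (Nat.mul_div_le n k) _
  have hcl : k * q ^ 2 * x.numClauseGroups ≤ 4 * n + k * q ^ 2 * (12 * k + 1) := by
    rw [numClauseGroups, quot_eq x.one_le_width, mul_add, ← hw]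
    exact Nat.add_le_add_right ((Nat.mul_div_le _ _).trans x.length_clauses_le) _
  have hkq : k * q ^ 2 * (12 * k + 1) ≤ 13 * n := by
    calc k * q ^ 2 * (12 * k + 1) ≤ q * q ^ 2 * (12 * q + q) := by gcongr
      _ = 13 * q ^ 4 := by ring
      _ ≤ 13 * n := by omega
  have hq : 1 ≤ q ^ 2 := Nat.one_le_pow _ _ h1
  have hkn : k ≤ n := x.groupSize_le.trans hb
  calc k * x.vertices.length
      ≤ k * (x.numVarGroups + x.numClauseGroups * (2 + 2 * 4 ^ k)) :=
        Nat.mul_le_mul_left _ x.length_vertices_le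
    _ ≤ k * (x.numVarGroups + x.numClauseGroups * (2 * q ^ 2 + 2 * (4 * q ^ 2))) := by
        rw [h5]; gcongr; omega
    _ = k * x.numVarGroups + 10 * (k * q ^ 2 * x.numClauseGroups) := by ring
    _ ≤ 300 * n := by omega

end Input

/-! ### Satisfying assignments and colorings -/

/-- A coloring of the vertices in the list `V`. -/
def IsVertexColoring (V : List Vertex) (α : Vertex → Finset Color) : Prop :=
  (∀ v ∈ V, α v ⊆ v.2.2.2.1.toFinset ∧ (α v).card = v.2.2.2.2) ∧
  ∀ u ∈ V, ∀ v ∈ V, vertexAdj u v = true → Disjoint (α u) (α v)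

theorem vertexAdj_iff {u v : Vertex} : vertexAdj u v = true ↔
    u.1 ≠ v.1 ∧ ∃ j ∈ u.2.2.1, j ∈ v.2.2.1 := by
  simp only [vertexAdj, Bool.and_eq_true, Bool.not_eq_true', beq_eq_false_iff_ne,
    List.any_eq_true, List.contains_iff_mem]

/-- Vertices with demand zero can be omitted, since they receive no color. -/
theorem exists_isVertexColoring_filter_iff (V : List Vertex) :
    (∃ α, IsVertexColoring (V.filter fun v => !(v.2.2.2.2 == 0)) α) ↔
      ∃ α, IsVertexColoring V α := by
  constructor
  · rintro ⟨α, h1, h2⟩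
    have hmem : ∀ v ∈ V, v.2.2.2.2 ≠ 0 → v ∈ V.filter fun v => !(v.2.2.2.2 == 0) :=
      fun v hv h0 => List.mem_filter.2 ⟨hv, by simpa using h0⟩
    refine ⟨fun v => if v.2.2.2.2 = 0 then ∅ else α v, fun v hv => ?_, fun u hu v hv h => ?_⟩
    · dsimp only
      split_ifs with h0
      · simp [h0]
      · exact h1 v (hmem v hv h0)
    · dsimp only
      by_cases h3 : u.2.2.2.2 = 0
      · simp [h3]
      by_cases h4 : v.2.2.2.2 = 0
      · simp [h4]
      rw [if_neg h3, if_neg h4]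
      exact h2 u (hmem u hu h3) v (hmem v hv h4) h
  · rintro ⟨α, h1, h2⟩
    exact ⟨α, fun v hv => h1 v (List.mem_filter.1 hv).1, fun u hu v hv =>
      h2 u (List.mem_filter.1 hu).1 v (List.mem_filter.1 hv).1⟩

/-- The heart of the reduction. Let `t` be the colors that represent the values of the literals of
a group `C` of clauses. If `sel` and `res` partition them such that `sel` has one color per clause
on average, and if, among the clauses in a row of the detecting matrix, and among those in its
complement, there are at least as many colors in `sel` as clauses, then `sel` has exactly one
color of every clause. -/
theorem exists_mem_sel {lit col : Type} [DecidableEq col] {k : ℕ} {C : List (List lit)}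
    {t : lit → col} (hC : 4 * C.length ≤ k * 4 ^ k) (h3 : ∀ c ∈ C, c.length = 3)
    (hnd : (C.flatten.map t).Nodup) {sel res : Finset col}
    (hsel : sel ⊆ (C.flatten.map t).toFinset) (hres : res ⊆ (C.flatten.map t).toFinset)
    (hdisj : Disjoint sel res) (hcs : sel.card = C.length) (hcr : res.card = 2 * C.length)
    (hrow : ∀ r ∈ detectRows k, ∀ s, ∃ A : Finset col,
      A ⊆ ((select C r s).flatten.map t).toFinset ∧ Disjoint A res ∧
        A.card = (select C r s).length) :
    ∀ c ∈ C, ∃ l ∈ c, t l ∈ sel := by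
  have hlen : C.flatten.length = 3 * C.length := by
    rw [List.length_flatten, List.map_congr_left (g := fun _ => 3) h3]
    simp [mul_comm]
  have hunion : sel ∪ res = (C.flatten.map t).toFinset := by
    refine Finset.eq_of_subset_of_card_le (Finset.union_subset hsel hres) ?_
    rw [Finset.card_union_of_disjoint hdisj, hcs, hcr, List.toFinset_card_of_nodup hnd,
      List.length_map, hlen]
    omega
  have hcount : ∀ R : List (List lit),
      (R.map fun c => c.countP fun l => decide (t l ∈ sel)).sum =
        R.flatten.countP fun l => decide (t l ∈ sel) := fun R => by
    rw [List.countP_flatten]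
  have hone := eq_one_of_le_sum_select (e := fun c => c.countP fun l => decide (t l ∈ sel)) hC
    (fun c hc => by rw [← h3 c hc]; exact List.countP_le_length) (by
      rw [hcount, ← hcs, List.countP_eq_length_filter]
      have hnd' : ((C.flatten.filter fun l => decide (t l ∈ sel)).map t).Nodup :=
        hnd.sublist (List.filter_sublist.map t)
      rw [← List.length_map (f := t), ← List.toFinset_card_of_nodup hnd']
      congr 1
      ext a
      simp only [List.mem_toFinset, List.mem_map, List.mem_filter, decide_eq_true_eq]
      constructor
      · rintro ⟨l, ⟨-, h⟩, rfl⟩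
        exact h
      · intro ha
        obtain ⟨l, hl, rfl⟩ := List.mem_map.1 (List.mem_toFinset.1 (hsel ha))
        exact ⟨l, ⟨hl, ha⟩, rfl⟩)
    (fun r hr s => by
      obtain ⟨A, hA, hAres, hcA⟩ := hrow r hr s
      rw [hcount, ← hcA, List.countP_eq_length_filter, ← List.length_map (f := t)]
      refine le_trans (Finset.card_le_card fun a ha => ?_) (List.toFinset_card_le _)
      obtain ⟨l, hl, rfl⟩ := List.mem_map.1 (List.mem_toFinset.1 (hA ha))
      have hlC : l ∈ C.flatten := ((select_sublist C r s).flatten).subset hl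
      have : t l ∈ sel ∪ res := by
        rw [hunion, List.mem_toFinset]
        exact List.mem_map.2 ⟨l, hlC, rfl⟩
      have hls : t l ∈ sel := (Finset.mem_union.1 this).resolve_right
        (Finset.disjoint_left.1 hAres ha)
      exact List.mem_toFinset.2 (List.mem_map.2
        ⟨l, List.mem_filter.2 ⟨hl, by simpa using hls⟩, rfl⟩))
  intro c hc
  have h1 := hone c hc
  obtain ⟨l, hl, h⟩ := List.countP_pos_iff.1 (by rw [h1]; exact one_pos)
  exact ⟨l, hl, by simpa using h⟩

theorem eq_of_mem_zip_of_nodup {α β : Type} {l : List α} (hl : l.Nodup) {r : List β} {a : α}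
    {b b' : β} (h : (a, b) ∈ l.zip r) (h' : (a, b') ∈ l.zip r) : b = b' := by
  have hn : ((l.zip r).map Prod.fst).Nodup := by
    refine hl.sublist ?_
    clear hl h h'
    induction l generalizing r with
    | nil => simp
    | cons a l ih => cases r with
      | nil => simp
      | cons b r => simpa using ih
  exact congrArg Prod.snd (List.inj_on_of_nodup_map hn h h' rfl)

theorem map_sublist_flatten {α β : Type} (C : List α) (f : α → List β) (g : α → β)
    (h : ∀ c ∈ C, g c ∈ f c) : (C.map g).Sublist (C.map f).flatten := by
  induction C with
  | nil => simp
  | cons c C ih =>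
    rw [List.map_cons, List.map_cons, List.flatten_cons, ← List.singleton_append]
    exact (List.singleton_sublist.2 (h c List.mem_cons_self)).append
      (ih fun c' hc' => h c' (List.mem_cons_of_mem _ hc'))

namespace Input

variable (x : Input)

/-- The formula is satisfiable. -/
def Sat : Prop := ∃ η : ℕ → Bool, ∀ c ∈ x.clauses, ∃ l ∈ c, η l.1 = l.2

theorem mem_allVertices {v : Vertex} : v ∈ x.allVertices ↔
    (∃ i < x.numVarGroups, x.varVertex i = v) ∨ ∃ j < x.numClauseGroups,
      v = x.selVertex j ∨ v = x.resVertex j ∨ ∃ r ∈ x.rows, ∃ s, v = x.rowVertex j r s := by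
  simp only [allVertices, List.mem_append, List.mem_map, List.mem_range, List.mem_flatMap,
    List.mem_cons, List.not_mem_nil, or_false, Bool.exists_bool]
  constructor
  · rintro (h | ⟨j, hj, h | h | ⟨r, hr, h | h⟩⟩)
    · exact Or.inl h
    · exact Or.inr ⟨j, hj, Or.inl h⟩
    · exact Or.inr ⟨j, hj, Or.inr (Or.inl h)⟩
    · exact Or.inr ⟨j, hj, Or.inr (Or.inr ⟨r, hr, Or.inr h⟩)⟩
    · exact Or.inr ⟨j, hj, Or.inr (Or.inr ⟨r, hr, Or.inl h⟩)⟩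
  · rintro (h | ⟨j, hj, h | h | ⟨r, hr, h | h⟩⟩)
    · exact Or.inl h
    · exact Or.inr ⟨j, hj, Or.inl h⟩
    · exact Or.inr ⟨j, hj, Or.inr (Or.inl h)⟩
    · exact Or.inr ⟨j, hj, Or.inr (Or.inr ⟨r, hr, Or.inr h⟩)⟩
    · exact Or.inr ⟨j, hj, Or.inr (Or.inr ⟨r, hr, Or.inl h⟩)⟩

/-- The color that stands for the values, in the assignment given by `τ`, of the variables in the
group of the literal `l`. -/
def trueColor (τ : ℕ → List Bool) (l : ℕ × Bool) : Color :=
  (x.slot (x.groupOf l.1), τ (x.groupOf l.1))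

theorem groupOf_lt_of_mem_group {j : ℕ} {l : ℕ × Bool} (hl : l ∈ (x.group j).flatten) :
    x.groupOf l.1 < x.numVarGroups := x.groupOf_lt (x.lt_of_mem_group hl)

theorem mem_touch_groupOf {j : ℕ} (hj : j < x.numClauseGroups) {l : ℕ × Bool}
    (hl : l ∈ (x.group j).flatten) : j ∈ x.touch (x.groupOf l.1) := x.mem_touch.2 ⟨hj, l, hl, rfl⟩

theorem nodup_trueColor (τ : ℕ → List Bool) {j : ℕ} (hj : j < x.numClauseGroups) :
    ((x.group j).flatten.map (x.trueColor τ)).Nodup := by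
  refine List.Nodup.of_map Prod.fst ?_
  rw [List.map_map]
  have h : (((x.group j).flatten.map fun l => x.groupOf l.1).map x.slot).Nodup := by
    refine (x.groupOf_injOn_group j).map_on fun i hi i' hi' h => ?_
    obtain ⟨l, hl, rfl⟩ := List.mem_map.1 hi
    obtain ⟨l', hl', rfl⟩ := List.mem_map.1 hi'
    exact x.slot_inj (x.groupOf_lt_of_mem_group hl) (x.groupOf_lt_of_mem_group hl')
      (x.mem_touch_groupOf hj hl) (x.mem_touch_groupOf hj hl') h
  rwa [List.map_map] at h

theorem mem_vecs {v : List Bool} : v ∈ x.vecs ↔ v.length = x.groupSize := mem_boolVecs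

theorem nodup_map_vecs (s : ℕ) : (x.vecs.map fun τ => (s, τ)).Nodup :=
  (nodup_boolVecs _).map fun _ _ h => (Prod.ext_iff.1 h).2

theorem length_vecs : x.vecs.length = 2 ^ x.groupSize := length_boolVecs _

theorem mem_litColors {l : ℕ × Bool} {c : Color} :
    c ∈ x.litColors l ↔ c.1 = x.slot (x.groupOf l.1) ∧ c.2.length = x.groupSize := by
  simp only [litColors, List.mem_map, mem_vecs]
  constructor
  · rintro ⟨τ, h, rfl⟩
    exact ⟨rfl, h⟩
  · rintro ⟨h1, h2⟩
    exact ⟨c.2, h2, by rw [← h1]⟩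

theorem mem_satColors {l : ℕ × Bool} {c : Color} :
    c ∈ x.satColors l ↔ c ∈ x.litColors l ∧
      l ∈ (members x.varBins (x.groupOf l.1)).zip c.2 := by
  rw [mem_litColors]
  simp only [satColors, List.mem_map, List.mem_filter, mem_vecs, List.contains_iff_mem]
  constructor
  · rintro ⟨τ, ⟨h, h'⟩, rfl⟩
    exact ⟨⟨rfl, h⟩, h'⟩
  · rintro ⟨⟨h1, h2⟩, h3⟩
    exact ⟨c.2, ⟨h2, h3⟩, by rw [← h1]⟩

/-- The vertex of a group of variables leaves exactly one color unused. -/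
theorem exists_unused {α : Vertex → Finset Color} (h : IsVertexColoring x.allVertices α) {i : ℕ}
    (hi : i < x.numVarGroups) :
    ∃ τ, ∀ τ', τ'.length = x.groupSize → (x.slot i, τ') ∉ α (x.varVertex i) → τ' = τ := by
  obtain ⟨h1, h2⟩ := h.1 _ (x.mem_allVertices.2 (Or.inl ⟨i, hi, rfl⟩))
  change α (x.varVertex i) ⊆ (x.vecs.map fun τ => (x.slot i, τ)).toFinset at h1
  change _ = x.vecs.tail.length at h2
  have hcard : ((x.vecs.map fun τ => (x.slot i, τ)).toFinset \ α (x.varVertex i)).card = 1 := by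
    rw [Finset.card_sdiff_of_subset h1, h2, List.toFinset_card_of_nodup (x.nodup_map_vecs _),
      List.length_map, List.length_tail, length_vecs]
    have := Nat.one_le_two_pow (n := x.groupSize)
    omega
  obtain ⟨c, hc⟩ := Finset.card_eq_one.1 hcard
  refine ⟨c.2, fun τ' hτ' hn => ?_⟩
  have : (x.slot i, τ') ∈ (x.vecs.map fun τ => (x.slot i, τ)).toFinset \ α (x.varVertex i) :=
    Finset.mem_sdiff.2 ⟨List.mem_toFinset.2 (List.mem_map.2 ⟨τ', x.mem_vecs.2 hτ', rfl⟩), hn⟩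
  rw [hc, Finset.mem_singleton] at this
  rw [← this]

/-- All vertices that are concerned with one group of clauses only use colors that stand for the
assignment, since the other colors are used by the vertices of the groups of variables. -/
theorem eq_trueColor_of_mem {α : Vertex → Finset Color} (h : IsVertexColoring x.allVertices α)
    {τ : ℕ → List Bool} (hτ : ∀ i < x.numVarGroups, ∀ τ', τ'.length = x.groupSize →
      (x.slot i, τ') ∉ α (x.varVertex i) → τ' = τ i)
    {v : Vertex} (hv : v ∈ x.allVertices) {j : ℕ} (hj : j < x.numClauseGroups)
    (h0 : v.1 ≠ 0) (htouch : v.2.2.1 = [j]) {l : ℕ × Bool} (hl : l ∈ (x.group j).flatten)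
    {c : Color} (hc : c ∈ α v) (hcl : c ∈ x.litColors l) : c = x.trueColor τ l := by
  obtain ⟨h1, h2⟩ := x.mem_litColors.1 hcl
  have hi := x.groupOf_lt_of_mem_group hl
  have hadj : vertexAdj (x.varVertex (x.groupOf l.1)) v = true := by
    rw [vertexAdj_iff]
    refine ⟨fun h => h0 h.symm, j, x.mem_touch_groupOf hj hl, ?_⟩
    rw [htouch]; exact List.mem_cons_self
  have hd := h.2 _ (x.mem_allVertices.2 (Or.inl ⟨_, hi, rfl⟩)) v hv hadj
  refine Prod.ext h1 (hτ _ hi c.2 h2 ?_)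
  rw [← h1]
  exact Finset.disjoint_right.1 hd hc

theorem subset_trueColor {α : Vertex → Finset Color} (h : IsVertexColoring x.allVertices α)
    {τ : ℕ → List Bool} (hτ : ∀ i < x.numVarGroups, ∀ τ', τ'.length = x.groupSize →
      (x.slot i, τ') ∉ α (x.varVertex i) → τ' = τ i)
    {v : Vertex} (hv : v ∈ x.allVertices) {j : ℕ} (hj : j < x.numClauseGroups)
    (h0 : v.1 ≠ 0) (htouch : v.2.2.1 = [j]) {W : List (ℕ × Bool)}
    (hW : W ⊆ (x.group j).flatten) (hcol : ∀ c ∈ v.2.2.2.1, ∃ l ∈ W, c ∈ x.litColors l) :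
    α v ⊆ (W.map (x.trueColor τ)).toFinset := by
  intro c hc
  obtain ⟨l, hl, hcl⟩ := hcol c (List.mem_toFinset.1 ((h.1 v hv).1 hc))
  rw [x.eq_trueColor_of_mem h hτ hv hj h0 htouch (hW hl) hc hcl]
  exact List.mem_toFinset.2 (List.mem_map.2 ⟨l, hl, rfl⟩)

theorem sat_of_coloring {α : Vertex → Finset Color} (h : IsVertexColoring x.allVertices α) :
    x.Sat := by
  have hex : ∀ i, ∃ τ, i < x.numVarGroups → ∀ τ', τ'.length = x.groupSize →
      (x.slot i, τ') ∉ α (x.varVertex i) → τ' = τ := fun i => by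
    by_cases hi : i < x.numVarGroups
    · obtain ⟨τ, hτ⟩ := x.exists_unused h hi
      exact ⟨τ, fun _ => hτ⟩
    · exact ⟨[], fun h => absurd h hi⟩
  choose τ hτ using hex
  refine ⟨fun v => decide ((v, true) ∈ (members x.varBins (x.groupOf v)).zip (τ (x.groupOf v))),
    fun c hc => ?_⟩
  obtain ⟨j, hj, hcj⟩ := x.exists_mem_group hc
  have msel : x.selVertex j ∈ x.allVertices := x.mem_allVertices.2 (Or.inr ⟨j, hj, Or.inl rfl⟩)
  have mres : x.resVertex j ∈ x.allVertices :=
    x.mem_allVertices.2 (Or.inr ⟨j, hj, Or.inr (Or.inl rfl)⟩)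
  have mrow : ∀ r ∈ x.rows, ∀ s, x.rowVertex j r s ∈ x.allVertices := fun r hr s =>
    x.mem_allVertices.2 (Or.inr ⟨j, hj, Or.inr (Or.inr ⟨r, hr, s, rfl⟩)⟩)
  obtain ⟨l, hl, hsel⟩ := exists_mem_sel (k := x.groupSize) (C := x.group j) (t := x.trueColor τ)
    (sel := α (x.selVertex j)) (res := α (x.resVertex j))
    (by rw [← x.width_spec]; exact Nat.mul_le_mul_left _ (x.length_group_le j))
    (fun c hc => x.length_clause (x.mem_clauses_of_mem_group hc))
    (x.nodup_trueColor τ hj)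
    (x.subset_trueColor h hτ msel hj one_ne_zero rfl (List.Subset.refl _) fun c hc => by
      obtain ⟨l, hl, hcl⟩ := List.mem_flatMap.1 hc
      exact ⟨l, hl, (x.mem_satColors.1 hcl).1⟩)
    (x.subset_trueColor h hτ mres hj two_ne_zero rfl (List.Subset.refl _) fun c hc =>
      List.mem_flatMap.1 hc)
    (h.2 _ msel _ mres (vertexAdj_iff.2
      ⟨by change (1 : ℕ) ≠ 2; norm_num, j, List.mem_cons_self, List.mem_cons_self⟩))
    (h.1 _ msel).2 (h.1 _ mres).2
    (fun r hr s => ⟨α (x.rowVertex j r s),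
      x.subset_trueColor h hτ (mrow r hr s) hj one_ne_zero rfl
        ((select_sublist _ r s).flatten).subset fun c hc => List.mem_flatMap.1 hc,
      h.2 _ (mrow r hr s) _ mres (vertexAdj_iff.2
        ⟨by change (1 : ℕ) ≠ 2; norm_num, j, List.mem_cons_self, List.mem_cons_self⟩),
      (h.1 _ (mrow r hr s)).2⟩) c hcj
  refine ⟨l, hl, ?_⟩
  have hlj : l ∈ (x.group j).flatten := List.mem_flatten.2 ⟨c, hcj, hl⟩
  -- The selected color is in the list of `selVertex` on account of some satisfied literal, which
  -- must be `l`, since different literals of the group have different colors.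
  obtain ⟨l', hl', hsat⟩ := List.mem_flatMap.1 (List.mem_toFinset.1 ((h.1 _ msel).1 hsel))
  obtain ⟨hlit, hzip⟩ := x.mem_satColors.1 hsat
  have heq := x.eq_trueColor_of_mem h hτ msel hj one_ne_zero rfl hl' hsel hlit
  obtain rfl := List.inj_on_of_nodup_map (x.nodup_trueColor τ hj) hlj hl' heq
  change l ∈ (members x.varBins (x.groupOf l.1)).zip (τ (x.groupOf l.1)) at hzip
  obtain ⟨v, s⟩ := l
  cases s with
  | true => simpa using hzip
  | false =>
    rw [decide_eq_false_iff_not]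
    exact fun h' => Bool.noConfusion (eq_of_mem_zip_of_nodup (x.nodup_members _) hzip h')

/-- The values of the variables of the group `i`, filled up to length `groupSize`. -/
def values (η : ℕ → Bool) (i : ℕ) : List Bool :=
  (members x.varBins i).map η ++
    List.replicate (x.groupSize - (members x.varBins i).length) false

theorem length_values (η : ℕ → Bool) (i : ℕ) : (x.values η i).length = x.groupSize := by
  have := x.length_members_le i
  simp only [values, List.length_append, List.length_map, List.length_replicate]
  omega

theorem mem_zip_values {η : ℕ → Bool} {i v : ℕ} (hv : v ∈ members x.varBins i) :
    (v, η v) ∈ (members x.varBins i).zip (x.values η i) := by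
  have h : ∀ (l : List ℕ) (r : List Bool), v ∈ l → (v, η v) ∈ l.zip (l.map η ++ r) := by
    intro l r hl
    induction l with
    | nil => simp at hl
    | cons a l ih =>
      rcases List.mem_cons.1 hl with rfl | hl
      · simp
      · simp [ih hl]
  exact h _ _ hv

theorem trueColor_mem_litColors (η : ℕ → Bool) (l : ℕ × Bool) :
    x.trueColor (x.values η) l ∈ x.litColors l :=
  x.mem_litColors.2 ⟨rfl, x.length_values η _⟩

/-- For an assignment `η` and a choice `pick` of a true literal in every clause, the colors of the
chosen literals of the group `j`. -/
def selColors (η : ℕ → Bool) (pick : NatClause → ℕ × Bool) (j : ℕ) : Finset Color :=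
  ((x.group j).map fun c => x.trueColor (x.values η) (pick c)).toFinset

/-- The colors of the literals of the group `j` that are not chosen. -/
def resColors (η : ℕ → Bool) (pick : NatClause → ℕ × Bool) (j : ℕ) : Finset Color :=
  ((x.group j).flatten.map (x.trueColor (x.values η))).toFinset \ x.selColors η pick j

theorem nodup_pick {η : ℕ → Bool} {pick : NatClause → ℕ × Bool}
    (hpick : ∀ c ∈ x.clauses, pick c ∈ c) {j : ℕ} (hj : j < x.numClauseGroups) :
    ((x.group j).map fun c => x.trueColor (x.values η) (pick c)).Nodup := by
  refine (x.nodup_trueColor (x.values η) hj).sublist ?_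
  rw [List.map_flatten]
  exact map_sublist_flatten _ _ _ fun c hc =>
    List.mem_map.2 ⟨_, hpick c (x.mem_clauses_of_mem_group hc), rfl⟩

theorem selColors_subset {η : ℕ → Bool} {pick : NatClause → ℕ × Bool}
    (hpick : ∀ c ∈ x.clauses, pick c ∈ c) (j : ℕ) : x.selColors η pick j ⊆
      ((x.group j).flatten.map (x.trueColor (x.values η))).toFinset := by
  intro a ha
  obtain ⟨c, hc, rfl⟩ := List.mem_map.1 (List.mem_toFinset.1 ha)
  exact List.mem_toFinset.2 (List.mem_map.2 ⟨_, List.mem_flatten.2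
    ⟨c, hc, hpick c (x.mem_clauses_of_mem_group hc)⟩, rfl⟩)

open Classical in
/-- The coloring for a satisfying assignment; the vertices of class 1 choose any suitable colors
among the selected ones. -/
noncomputable def coloring (η : ℕ → Bool) (pick : NatClause → ℕ × Bool) (v : Vertex) :
    Finset Color :=
  if v.1 = 0 then v.2.2.2.1.toFinset.filter fun c => c.2 ≠ x.values η v.2.1
  else if v.1 = 2 then x.resColors η pick v.2.1
  else if h : ∃ A ⊆ v.2.2.2.1.toFinset ∩ x.selColors η pick v.2.1, A.card = v.2.2.2.2
    then h.choose else ∅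

theorem coloring_class_one {η : ℕ → Bool} {pick : NatClause → ℕ × Bool} {v : Vertex}
    (hv : v.1 = 1) {A : Finset Color}
    (hA : A ⊆ v.2.2.2.1.toFinset ∩ x.selColors η pick v.2.1) (hcard : A.card = v.2.2.2.2) :
    x.coloring η pick v ⊆ v.2.2.2.1.toFinset ∩ x.selColors η pick v.2.1 ∧
      (x.coloring η pick v).card = v.2.2.2.2 := by
  have h : ∃ A ⊆ v.2.2.2.1.toFinset ∩ x.selColors η pick v.2.1, A.card = v.2.2.2.2 :=
    ⟨A, hA, hcard⟩
  rw [coloring, if_neg (by omega), if_neg (by omega), dif_pos h]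
  exact h.choose_spec

theorem coloring_selVertex {η : ℕ → Bool} {pick : NatClause → ℕ × Bool}
    (hpick : ∀ c ∈ x.clauses, pick c ∈ c ∧ η (pick c).1 = (pick c).2) {j : ℕ}
    (hj : j < x.numClauseGroups) :
    x.coloring η pick (x.selVertex j) ⊆
        (x.selVertex j).2.2.2.1.toFinset ∩ x.selColors η pick j ∧
      (x.coloring η pick (x.selVertex j)).card = (x.selVertex j).2.2.2.2 := by
  refine x.coloring_class_one (A := x.selColors η pick j) rfl
    (Finset.subset_inter (fun a ha => ?_) (Finset.Subset.refl _)) ?_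
  · obtain ⟨c, hc, rfl⟩ := List.mem_map.1 (List.mem_toFinset.1 ha)
    have hcl := x.mem_clauses_of_mem_group hc
    obtain ⟨h1, h2⟩ := hpick c hcl
    refine List.mem_toFinset.2 (List.mem_flatMap.2 ⟨pick c, List.mem_flatten.2 ⟨c, hc, h1⟩,
      x.mem_satColors.2 ⟨x.trueColor_mem_litColors η _, ?_⟩⟩)
    have := x.mem_zip_values (η := η) (x.mem_members_groupOf (x.lt_of_mem_clause hcl h1))
    rwa [h2] at this
  · rw [selColors, List.toFinset_card_of_nodup (x.nodup_pick (fun c hc => (hpick c hc).1) hj),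
      List.length_map]
    rfl

theorem coloring_rowVertex {η : ℕ → Bool} {pick : NatClause → ℕ × Bool}
    (hpick : ∀ c ∈ x.clauses, pick c ∈ c) {j : ℕ} (hj : j < x.numClauseGroups) (r : List Bool)
    (s : Bool) :
    x.coloring η pick (x.rowVertex j r s) ⊆
        (x.rowVertex j r s).2.2.2.1.toFinset ∩ x.selColors η pick j ∧
      (x.coloring η pick (x.rowVertex j r s)).card = (x.rowVertex j r s).2.2.2.2 := by
  have hsub := select_sublist (x.group j) r s
  refine x.coloring_class_one (A := ((select (x.group j) r s).map fun c =>
    x.trueColor (x.values η) (pick c)).toFinset) rfl (fun a ha => ?_) ?_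
  · obtain ⟨c, hc, rfl⟩ := List.mem_map.1 (List.mem_toFinset.1 ha)
    have hcl := x.mem_clauses_of_mem_group (hsub.subset hc)
    refine Finset.mem_inter.2 ⟨List.mem_toFinset.2 (List.mem_flatMap.2 ⟨pick c,
      List.mem_flatten.2 ⟨c, hc, hpick c hcl⟩, x.trueColor_mem_litColors η _⟩), ?_⟩
    exact List.mem_toFinset.2 (List.mem_map.2 ⟨c, hsub.subset hc, rfl⟩)
  · rw [List.toFinset_card_of_nodup ((x.nodup_pick hpick hj).sublist (hsub.map _)),
      List.length_map]
    rfl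

theorem coloring_resVertex {η : ℕ → Bool} {pick : NatClause → ℕ × Bool}
    (hpick : ∀ c ∈ x.clauses, pick c ∈ c) {j : ℕ} (hj : j < x.numClauseGroups) :
    x.coloring η pick (x.resVertex j) = x.resColors η pick j ∧
    x.resColors η pick j ⊆ (x.resVertex j).2.2.2.1.toFinset ∧
      (x.resColors η pick j).card = (x.resVertex j).2.2.2.2 := by
  refine ⟨rfl, fun a ha => ?_, ?_⟩
  · obtain ⟨l, hl, rfl⟩ := List.mem_map.1 (List.mem_toFinset.1 (Finset.mem_sdiff.1 ha).1)
    exact List.mem_toFinset.2 (List.mem_flatMap.2 ⟨l, hl, x.trueColor_mem_litColors η l⟩)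
  · rw [resColors, Finset.card_sdiff_of_subset (x.selColors_subset hpick j),
      List.toFinset_card_of_nodup (x.nodup_trueColor _ hj), selColors,
      List.toFinset_card_of_nodup (x.nodup_pick hpick hj), List.length_map, List.length_map,
      length_flatten_group]
    change _ = 2 * (x.group j).length
    omega

theorem coloring_varVertex (η : ℕ → Bool) (pick : NatClause → ℕ × Bool) (i : ℕ) :
    x.coloring η pick (x.varVertex i) =
      (x.vecs.map fun τ => (x.slot i, τ)).toFinset.erase (x.slot i, x.values η i) := by
  ext c
  change c ∈ Finset.filter _ _ ↔ _
  rw [Finset.mem_filter, Finset.mem_erase, and_comm]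
  refine and_congr_left fun hc => not_congr ?_
  obtain ⟨τ, -, rfl⟩ := List.mem_map.1 (List.mem_toFinset.1 hc)
  change τ = x.values η i ↔ _
  simp

/-- The vertices of groups of variables leave the colors of the assignment to the others. -/
theorem disjoint_coloring_varVertex {η : ℕ → Bool} {pick : NatClause → ℕ × Bool} {i j : ℕ}
    (hi : i < x.numVarGroups) (hj : j < x.numClauseGroups) (hij : j ∈ x.touch i)
    {A : Finset Color} (hA : A ⊆ ((x.group j).flatten.map (x.trueColor (x.values η))).toFinset) :
    Disjoint (x.coloring η pick (x.varVertex i)) A := by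
  rw [Finset.disjoint_left]
  intro c hc hcA
  rw [coloring_varVertex, Finset.mem_erase] at hc
  obtain ⟨l, hl, rfl⟩ := List.mem_map.1 (List.mem_toFinset.1 (hA hcA))
  obtain ⟨τ, -, h⟩ := List.mem_map.1 (List.mem_toFinset.1 hc.2)
  have := x.slot_inj hi (x.groupOf_lt_of_mem_group hl) hij (x.mem_touch_groupOf hj hl)
    (congrArg Prod.fst h)
  exact hc.1 (by rw [this]; rfl)

theorem coloring_of_sat (h : x.Sat) : ∃ α, IsVertexColoring x.allVertices α := by
  obtain ⟨η, hη⟩ := h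
  have hex : ∀ c, ∃ l, c ∈ x.clauses → l ∈ c ∧ η l.1 = l.2 := fun c => by
    by_cases hc : c ∈ x.clauses
    · obtain ⟨l, hl⟩ := hη c hc
      exact ⟨l, fun _ => hl⟩
    · exact ⟨default, fun h => absurd h hc⟩
  choose pick hpick using hex
  have hpick' : ∀ c ∈ x.clauses, pick c ∈ c := fun c hc => (hpick c hc).1
  -- What is needed about the vertices that belong to a group of clauses.
  have hgroup : ∀ v ∈ x.allVertices, v.1 ≠ 0 → ∃ j < x.numClauseGroups, v.2.2.1 = [j] ∧
      ((v.1 = 1 ∧ x.coloring η pick v ⊆ x.selColors η pick j) ∨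
        (v.1 = 2 ∧ x.coloring η pick v = x.resColors η pick j)) := by
    intro v hv h0
    rcases x.mem_allVertices.1 hv with ⟨i, -, rfl⟩ | ⟨j, hj, rfl | rfl | ⟨r, hr, s, rfl⟩⟩
    · exact absurd rfl h0
    · exact ⟨j, hj, rfl, Or.inl ⟨rfl,
        (x.coloring_selVertex hpick hj).1.trans Finset.inter_subset_right⟩⟩
    · exact ⟨j, hj, rfl, Or.inr ⟨rfl, (x.coloring_resVertex hpick' hj).1⟩⟩
    · exact ⟨j, hj, rfl, Or.inl ⟨rfl,
        (x.coloring_rowVertex hpick' hj r s).1.trans Finset.inter_subset_right⟩⟩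
  have hvar : ∀ u ∈ x.allVertices, ∀ v ∈ x.allVertices, u.1 = 0 → vertexAdj u v = true →
      Disjoint (x.coloring η pick u) (x.coloring η pick v) := by
    intro u hu v hv hu0 huv
    obtain ⟨hne, j', hj'u, hj'v⟩ := vertexAdj_iff.1 huv
    obtain ⟨j, hj, htouch, hcol⟩ := hgroup v hv fun h => hne (hu0.trans h.symm)
    rw [htouch, List.mem_singleton] at hj'v
    subst hj'v
    rcases x.mem_allVertices.1 hu with ⟨i, hi, rfl⟩ | ⟨j, hj, rfl | rfl | ⟨r, hr, s, rfl⟩⟩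
    · refine x.disjoint_coloring_varVertex hi hj hj'u ?_
      rcases hcol with ⟨-, hcol⟩ | ⟨-, hcol⟩
      · exact hcol.trans (x.selColors_subset hpick' _)
      · rw [hcol]; exact Finset.sdiff_subset
    · exact absurd hu0 one_ne_zero
    · exact absurd hu0 two_ne_zero
    · exact absurd hu0 one_ne_zero
  refine ⟨x.coloring η pick, fun v hv => ?_, fun u hu v hv huv => ?_⟩
  · rcases x.mem_allVertices.1 hv with ⟨i, -, rfl⟩ | ⟨j, hj, rfl | rfl | ⟨r, hr, s, rfl⟩⟩
    · rw [coloring_varVertex]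
      refine ⟨Finset.erase_subset _ _, ?_⟩
      rw [Finset.card_erase_of_mem (List.mem_toFinset.2 (List.mem_map.2
        ⟨_, x.mem_vecs.2 (x.length_values η i), rfl⟩)),
        List.toFinset_card_of_nodup (x.nodup_map_vecs _), List.length_map]
      change _ = x.vecs.tail.length
      rw [List.length_tail]
    · have := x.coloring_selVertex hpick hj
      exact ⟨this.1.trans Finset.inter_subset_left, this.2⟩
    · have := x.coloring_resVertex (η := η) hpick' hj
      rw [this.1]
      exact this.2
    · have := x.coloring_rowVertex (η := η) hpick' hj r s
      exact ⟨this.1.trans Finset.inter_subset_left, this.2⟩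
  · obtain ⟨hne, j, hju, hjv⟩ := vertexAdj_iff.1 huv
    by_cases hu0 : u.1 = 0
    · exact hvar u hu v hv hu0 huv
    by_cases hv0 : v.1 = 0
    · exact (hvar v hv u hu hv0 (vertexAdj_iff.2 ⟨hne.symm, j, hjv, hju⟩)).symm
    obtain ⟨j₁, -, ht₁, h₁⟩ := hgroup u hu hu0
    obtain ⟨j₂, -, ht₂, h₂⟩ := hgroup v hv hv0
    rw [ht₁, List.mem_singleton] at hju
    rw [ht₂, List.mem_singleton] at hjv
    subst hju hjv
    rcases h₁ with ⟨c₁, h₁⟩ | ⟨c₁, h₁⟩ <;> rcases h₂ with ⟨c₂, h₂⟩ | ⟨c₂, h₂⟩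
    · exact absurd (c₁.trans c₂.symm) hne
    · rw [h₂]; exact Finset.disjoint_of_subset_left h₁ Finset.disjoint_sdiff
    · rw [h₁]; exact Finset.disjoint_of_subset_right h₂ Finset.sdiff_disjoint
    · exact absurd (c₁.trans c₂.symm) hne

theorem sat_iff : x.Sat ↔ ∃ α, IsVertexColoring x.vertices α := by
  rw [vertices, exists_isVertexColoring_filter_iff]
  exact ⟨x.coloring_of_sat, fun ⟨_, h⟩ => x.sat_of_coloring h⟩

end Input

/-! ### The instance that is output -/

namespace Input

variable (x : Input)

theorem class_lt {v : Vertex} (hv : v ∈ x.vertices) : v.1 < 3 := by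
  rcases x.mem_allVertices.1 (List.mem_filter.1 hv).1 with
    ⟨i, -, rfl⟩ | ⟨j, hj, rfl | rfl | ⟨r, hr, s, rfl⟩⟩
  · exact Nat.zero_lt_succ _
  · exact Nat.lt_succ_of_lt (Nat.lt_succ_self 1)
  · exact Nat.lt_succ_self 2
  · exact Nat.lt_succ_of_lt (Nat.lt_succ_self 1)

theorem demand_le_two_mul {v : Vertex} (hv : v ∈ x.vertices) : v.2.2.2.2 ≤ 2 * x.1.2.1 := by
  have hw := x.width_le_b
  rcases x.mem_allVertices.1 (List.mem_filter.1 hv).1 with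
    ⟨i, -, rfl⟩ | ⟨j, hj, rfl | rfl | ⟨r, hr, s, rfl⟩⟩
  · change x.vecs.tail.length ≤ _
    rw [List.length_tail, length_vecs]
    have := x.two_pow_groupSize_le
    omega
  · change (x.group j).length ≤ _
    have := x.length_group_le j
    omega
  · change 2 * (x.group j).length ≤ _
    have := x.length_group_le j
    omega
  · change (select (x.group j) r s).length ≤ _
    have := x.length_group_le j
    have := (select_sublist (x.group j) r s).length_le
    omega

theorem colors_subset_palette {v : Vertex} (hv : v ∈ x.vertices) :
    ∀ c ∈ v.2.2.2.1, c ∈ x.palette := by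
  have hpal : ∀ i < x.numVarGroups, ∀ τ ∈ x.vecs, (x.slot i, τ) ∈ x.palette := fun i hi τ hτ =>
    List.mem_flatMap.2 ⟨x.slot i, List.mem_range.2 (x.slot_lt hi), List.mem_map.2 ⟨τ, hτ, rfl⟩⟩
  have hlit : ∀ j, ∀ l ∈ (x.group j).flatten, ∀ c ∈ x.litColors l, c ∈ x.palette := by
    intro j l hl c hc
    obtain ⟨τ, hτ, rfl⟩ := List.mem_map.1 hc
    exact hpal _ (x.groupOf_lt_of_mem_group hl) τ hτ
  rcases x.mem_allVertices.1 (List.mem_filter.1 hv).1 with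
    ⟨i, hi, rfl⟩ | ⟨j, hj, rfl | rfl | ⟨r, hr, s, rfl⟩⟩
  · intro c hc
    obtain ⟨τ, hτ, rfl⟩ := List.mem_map.1 hc
    exact hpal i hi τ hτ
  · intro c hc
    obtain ⟨l, hl, hcl⟩ := List.mem_flatMap.1 hc
    exact hlit j l hl c (x.mem_satColors.1 hcl).1
  · intro c hc
    obtain ⟨l, hl, hcl⟩ := List.mem_flatMap.1 hc
    exact hlit j l hl c hcl
  · intro c hc
    obtain ⟨l, hl, hcl⟩ := List.mem_flatMap.1 hc
    exact hlit j l (((select_sublist _ r s).flatten).subset hl) c hcl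

theorem nodup_palette : x.palette.Nodup := by
  rw [palette, List.nodup_flatMap]
  refine ⟨fun s _ => x.nodup_map_vecs s, List.nodup_range.imp fun {s s'} h => ?_⟩
  rw [Function.onFun, List.disjoint_left]
  intro c hc hc'
  obtain ⟨τ, -, rfl⟩ := List.mem_map.1 hc
  obtain ⟨τ', -, h'⟩ := List.mem_map.1 hc'
  exact h (congrArg Prod.fst h').symm

/-- The instance whose vertices are the positions in `vertices`, and whose colors are the
positions in `palette`. -/
def toInstance : NonuniformInstance x.palette.length (2 * x.1.2.1) where
  numVertices := x.vertices.length
  graph :=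
    { Adj := fun u v => vertexAdj x.vertices[u] x.vertices[v] = true
      symm := ⟨fun u v h => by
        obtain ⟨h1, j, h2, h3⟩ := vertexAdj_iff.1 h
        exact vertexAdj_iff.2 ⟨h1.symm, j, h3, h2⟩⟩
      loopless := ⟨fun u h => (vertexAdj_iff.1 h).1 rfl⟩ }
  list v := Finset.univ.filter fun c => x.palette[c] ∈ x.vertices[v].2.2.2.1
  demand v := x.vertices[v].2.2.2.2
  one_le_demand v := by
    have : x.vertices[v] ∈ x.vertices := List.getElem_mem _
    have := (List.mem_filter.1 this).2
    rw [Bool.not_eq_true', beq_eq_false_iff_ne] at this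
    omega
  demand_le v := x.demand_le_two_mul (List.getElem_mem _)

/-- The coloring of the graph by the classes of the vertices. -/
def toColoring : x.toInstance.graph.Coloring (Fin 3) :=
  SimpleGraph.Coloring.mk (fun v => ⟨x.vertices[v].1, x.class_lt (List.getElem_mem _)⟩)
    fun {_ _} h he => (vertexAdj_iff.1 h).1 (congrArg Fin.val he)

theorem encodeOutput_eq : encodeOutput x.toInstance x.toColoring = enc x.output := by
  have h : ∀ {α β : Type} [Enc β] (l : List α) (f : α → β),
      enc (l.map f) = encodeList (List.ofFn fun i : Fin l.length => enc (f l[i])) := by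
    intro α β _ l f
    refine congrArg encodeList (List.ext_getElem (by simp) fun i h1 h2 => by simp)
  have hbool : ∀ (b : Bool) (p : Prop) (_ : Decidable p), (p ↔ b = true) →
      encodeBool (decide p) = enc b := fun b p _ hb => by
    refine congrArg encodeBool ?_
    rw [Bool.eq_iff_iff, decide_eq_true_iff, hb]
  refine congrArg encodeList (List.cons_eq_cons.2 ⟨rfl, List.cons_eq_cons.2 ⟨rfl,
    List.cons_eq_cons.2 ⟨rfl, List.cons_eq_cons.2 ⟨?_, List.cons_eq_cons.2 ⟨?_,
    List.cons_eq_cons.2 ⟨?_, List.cons_eq_cons.2 ⟨?_, rfl⟩⟩⟩⟩⟩⟩⟩)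
  · dsimp only [output]
    rw [h]
    refine congrArg encodeList (congrArg List.ofFn (funext fun u => ?_))
    rw [h]
    exact congrArg encodeList (congrArg List.ofFn (funext fun v => hbool _ _ _ Iff.rfl))
  · dsimp only [output]
    rw [h]
    refine congrArg encodeList (congrArg List.ofFn (funext fun u => ?_))
    rw [h]
    refine congrArg encodeList (congrArg List.ofFn (funext fun c => hbool _ _ _ ?_))
    rw [List.contains_iff_mem]
    change c ∈ Finset.filter _ _ ↔ _
    rw [Finset.mem_filter, and_iff_right (Finset.mem_univ _)]
  · dsimp only [output]
    rw [h]; rfl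
  · dsimp only [output]
    rw [h]; rfl

/-- Colorings of the vertex list and of the instance are the same. -/
theorem colorable_iff : x.toInstance.Colorable ↔ ∃ α, IsVertexColoring x.vertices α := by
  have hinj : Function.Injective fun c : Fin x.palette.length => x.palette[c] := fun c c' h =>
    Fin.ext ((x.nodup_palette.getElem_inj_iff).1 h)
  constructor
  · rintro ⟨α, h1, h2⟩
    have hidx : ∀ v ∈ x.vertices, ∃ i : Fin x.vertices.length, x.vertices[i] = v := fun v hv =>
      let ⟨i, hi, h⟩ := List.getElem_of_mem hv
      ⟨⟨i, hi⟩, h⟩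
    choose idx hidx using hidx
    refine ⟨fun v => if hv : v ∈ x.vertices then (α (idx v hv)).map ⟨_, hinj⟩ else ∅,
      fun v hv => ?_, fun u hu v hv h => ?_⟩
    · dsimp only
      rw [dif_pos hv]
      refine ⟨fun c hc => ?_, ?_⟩
      · obtain ⟨i, hi, rfl⟩ := Finset.mem_map.1 hc
        have := (Finset.mem_filter.1 ((h1 (idx v hv)).1 hi)).2
        rw [hidx v hv] at this
        exact List.mem_toFinset.2 this
      · rw [Finset.card_map, (h1 (idx v hv)).2]
        change (x.vertices[idx v hv]).2.2.2.2 = _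
        rw [hidx v hv]
    · dsimp only
      rw [dif_pos hu, dif_pos hv, Finset.disjoint_map]
      refine h2 _ _ ?_
      change vertexAdj x.vertices[idx u hu] x.vertices[idx v hv] = true
      rwa [hidx u hu, hidx v hv]
  · rintro ⟨α, h1, h2⟩
    refine ⟨fun v => Finset.univ.filter fun c => x.palette[c] ∈ α x.vertices[v],
      fun v => ⟨fun c hc => ?_, ?_⟩, fun u v h => ?_⟩
    · have hv : x.vertices[v] ∈ x.vertices := List.getElem_mem _
      exact Finset.mem_filter.2 ⟨Finset.mem_univ _,
        List.mem_toFinset.1 ((h1 _ hv).1 (Finset.mem_filter.1 hc).2)⟩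
    · have hv : x.vertices[v] ∈ x.vertices := List.getElem_mem _
      refine Eq.trans ?_ (h1 _ hv).2
      rw [← Finset.card_map ⟨_, hinj⟩]
      congr 1
      ext c
      simp only [Finset.mem_map, Finset.mem_filter, Finset.mem_univ, true_and,
        Function.Embedding.coeFn_mk]
      constructor
      · rintro ⟨i, hi, rfl⟩
        exact hi
      · intro hc
        obtain ⟨i, hi, rfl⟩ := List.getElem_of_mem
          (x.colors_subset_palette hv c (List.mem_toFinset.1 ((h1 _ hv).1 hc)))
        exact ⟨⟨i, hi⟩, hc, rfl⟩
    · have := h2 _ (List.getElem_mem u.2) _ (List.getElem_mem v.2) h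
      rw [Finset.disjoint_left] at this ⊢
      intro c hc hc'
      exact this (Finset.mem_filter.1 hc).2 (Finset.mem_filter.1 hc').2

/-! ### Inputs from formulas -/

/-- The clauses of a formula with `n` variables, as clauses over the variables `0, 1, 2, …`. -/
def natClauses {n : ℕ} (φ : CNF n) : List NatClause := φ.map fun c => c.map fun l => (l.1.val, l.2)

theorem map_fst_natClause {n : ℕ} (c : Clause n) :
    (c.map fun l => (l.1.val, l.2)).map Prod.fst = (c.map Prod.fst).map Fin.val := by
  rw [List.map_map, List.map_map]; rfl

/-- The input that belongs to a formula and a number `b`. -/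
def ofCNF {n : ℕ} (φ : CNF n) (hφ : φ.Is34) (b : ℕ) (hb : 2 ≤ b) (hbn : b ≤ n) : Input :=
  ⟨(n, b, natClauses φ, ()), hb, hbn, by
    intro c hc'
    obtain ⟨c, hc, rfl⟩ := List.mem_map.1 hc'
    refine ⟨by rw [List.length_map]; exact (hφ.1 c hc).1, ?_, ?_⟩
    · rw [map_fst_natClause]
      exact (hφ.1 c hc).2.map Fin.val_injective
    · intro l hl
      obtain ⟨l, -, rfl⟩ := List.mem_map.1 hl
      exact l.1.2, by
    intro v hv
    refine le_trans (le_of_eq ?_) (hφ.2 ⟨v, hv⟩)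
    change List.countP _ (List.map _ φ) = _
    rw [List.countP_map]
    refine List.countP_congr fun c _ => ?_
    rw [Function.comp_apply, List.contains_iff_mem, map_fst_natClause, decide_eq_true_iff,
      List.mem_map]
    constructor
    · rintro ⟨u, hu, rfl⟩
      exact hu
    · exact fun h => ⟨_, h, rfl⟩⟩

variable {n : ℕ} (φ : CNF n) (hφ : φ.Is34) (b : ℕ) (hb : 2 ≤ b) (hbn : b ≤ n)

theorem enc_ofCNF : enc (ofCNF φ hφ b hb hbn) = encodeInput φ b := by
  have h : enc (natClauses φ) = encodeList (φ.map encodeClause) := by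
    change encodeList ((List.map _ φ).map enc) = _
    rw [List.map_map]
    congr 1
    refine List.map_congr_left fun c _ => ?_
    change encodeList ((List.map _ c).map enc) = encodeList _
    rw [List.map_map]
    rfl
  rw [encodeInput, ← h]
  rfl

theorem sat_ofCNF : (ofCNF φ hφ b hb hbn).Sat ↔ φ.Satisfiable := by
  constructor
  · rintro ⟨η, h⟩
    refine ⟨fun v => η v, fun c hc => ?_⟩
    obtain ⟨l', hl', h⟩ := h _ (List.mem_map.2 ⟨c, hc, rfl⟩)
    obtain ⟨l, hl, rfl⟩ := List.mem_map.1 hl'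
    exact ⟨l, hl, h⟩
  · rintro ⟨η, h⟩
    refine ⟨fun v => if hv : v < n then η ⟨v, hv⟩ else false, fun c hc' => ?_⟩
    obtain ⟨c, hc, rfl⟩ := List.mem_map.1 hc'
    obtain ⟨l, hl, h⟩ := h c hc
    refine ⟨_, List.mem_map.2 ⟨l, hl, rfl⟩, ?_⟩
    simpa using h

theorem esize_le (x : Input) : esize x ≤ 12 * x.numVars ^ 2 + 42 * x.numVars + 4 := by
  have h1 : esize x = (x.numVars + 1) + ((x.1.2.1 + 1) + (esize x.clauses + 1)) := by
    rw [← esize_nat, ← esize_nat]; rfl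
  have h2 : x.1.2.1 ≤ x.numVars := x.2.2.1
  have h3 : esize x.clauses ≤ x.clauses.length * (3 * (x.numVars + 3) + 1) + 1 :=
    esize_list_le fun c hc => by
      refine (esize_list_le (s := x.numVars + 3) fun l hl => ?_).trans
        (by rw [x.length_clause hc])
      have h4 := x.lt_of_mem_clause hc hl
      have h5 := esize_bool l.2
      change esize l.1 + esize l.2 ≤ _
      rw [esize_nat]
      omega
  have h6 : x.clauses.length * (3 * (x.numVars + 3) + 1) ≤
      4 * x.numVars * (3 * (x.numVars + 3) + 1) := Nat.mul_le_mul_right _ x.length_clauses_le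
  have h7 : 4 * x.numVars * (3 * (x.numVars + 3) + 1) = 12 * x.numVars ^ 2 + 40 * x.numVars := by
    ring
  omega

end Input

theorem le_of_le_div_logb {n b : ℕ} (hb : 2 ≤ b) (h : (b : ℝ) ≤ (n : ℝ) / Real.logb 2 (n : ℝ)) :
    b ≤ n := by
  have hb' : (2 : ℝ) ≤ b := by exact_mod_cast hb
  have hn : 2 ≤ n := by
    by_contra hn
    have : n = 0 ∨ n = 1 := by omega
    rcases this with rfl | rfl <;> norm_num at h <;> linarith
  have hlog : 1 ≤ Real.logb 2 (n : ℝ) := by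
    rw [Real.le_logb_iff_rpow_le (by norm_num) (by positivity), Real.rpow_one]
    exact_mod_cast hn
  have : (b : ℝ) ≤ n := h.trans (div_le_self (by positivity) hlog)
  exact_mod_cast this

end ListColoring

theorem mainTheorem4 :
    ∃ (K : ℝ) (P : Polynomial ℕ) (A : ListColoring.Prog),
      ∀ (n : ℕ) (φ : ListColoring.CNF n), φ.Is34 →
      ∀ b : ℕ, 2 ≤ b → (b : ℝ) ≤ (n : ℝ) / Real.logb 2 (n : ℝ) →
        ∃ (a : ℕ) (I : ListColoring.NonuniformInstance a (2 * b))
          (χ : I.graph.Coloring (Fin 3)) (t : ℕ),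
          (φ.Satisfiable ↔ I.Colorable) ∧
          (a : ℝ) ≤ K * ((b : ℝ) ^ 2 * Real.logb 2 (b : ℝ)) ∧
          (I.numVertices : ℝ) ≤ K * ((n : ℝ) / Real.logb 2 (b : ℝ)) ∧
          A.Runs (ListColoring.encodeInput φ b) (ListColoring.encodeOutput I χ) t ∧
          t ≤ P.eval n := by
  obtain ⟨A, P, hA⟩ := ListColoring.Input.polyTime_output
  refine ⟨1200, P.comp (12 * .X ^ 2 + 42 * .X + 4), A, fun n φ hφ b hb hbn => ?_⟩
  have hbn' := ListColoring.le_of_le_div_logb hb hbn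
  let x := ListColoring.Input.ofCNF φ hφ b hb hbn'
  obtain ⟨t, ht, hrun⟩ := hA x
  have hb1 : (1 : ℝ) < b := by exact_mod_cast hb
  have hlog : 1 ≤ Real.logb 2 (b : ℝ) := by
    rw [Real.le_logb_iff_rpow_le (by norm_num) (by positivity), Real.rpow_one]
    exact_mod_cast hb
  refine ⟨x.palette.length, x.toInstance, x.toColoring, t, ?_, ?_, ?_, ?_, ?_⟩
  · exact (ListColoring.Input.sat_ofCNF φ hφ b hb hbn').symm.trans
      (x.sat_iff.trans x.colorable_iff.symm)
  · have h1 : (x.palette.length : ℝ) ≤ 26 * (b : ℝ) ^ 2 := by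
      exact_mod_cast x.length_palette_le
    have h2 : (b : ℝ) ^ 2 * 1 ≤ (b : ℝ) ^ 2 * Real.logb 2 (b : ℝ) := by gcongr
    have h3 : (0 : ℝ) ≤ (b : ℝ) ^ 2 := by positivity
    linarith
  · change (x.vertices.length : ℝ) ≤ _
    have h1 : (x.groupSize : ℝ) * x.vertices.length ≤ 300 * n := by
      exact_mod_cast x.groupSize_mul_length_vertices_le
    have h2 : Real.logb 2 (b : ℝ) ≤ 4 * x.groupSize := by
      rw [Real.logb_le_iff_le_rpow (by norm_num) (by positivity)]
      have h3 : b ≤ 16 ^ x.groupSize := x.groupSize_spec.2.2.le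
      have h4 : ((2 : ℝ) ^ (4 * (x.groupSize : ℝ))) = ((16 ^ x.groupSize : ℕ) : ℝ) := by
        rw [Real.rpow_mul (by norm_num)]
        norm_num
      rw [h4]
      exact_mod_cast h3
    rw [← mul_div_assoc, le_div_iff₀ (by linarith)]
    calc (x.vertices.length : ℝ) * Real.logb 2 (b : ℝ)
        ≤ x.vertices.length * (4 * x.groupSize) := by gcongr
      _ = 4 * (x.groupSize * x.vertices.length) := by ring
      _ ≤ 1200 * n := by linarith
  · rw [show ListColoring.Enc.enc x = _ from ListColoring.Input.enc_ofCNF φ hφ b hb hbn',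
      ← x.encodeOutput_eq] at hrun
    exact hrun
  · rw [Polynomial.eval_comp]
    refine ht.trans (ListColoring.eval_mono P ?_)
    have : (12 * Polynomial.X ^ 2 + 42 * Polynomial.X + 4 : Polynomial ℕ).eval n =
        12 * n ^ 2 + 42 * n + 4 := by simp
    rw [this]
    exact x.esize_le
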